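/- **Setting.** Let $\mathbb N=\{1,2,\dots\}$. For families $\mathcal F,\mathcal G$ of finite subsets of $\mathbb N$, let $\mathcal F[\mathcal G]$ be the family of all unions $\bigcup_{i=1}^k G_i$ with $G_i\in\mathcal G$ nonempty, $G_1<\dots<G_k$ and $\{\min G_1,\dots,\min G_k\}\in\mathcal F$. Put $[\mathcal F]^1=\mathcal F$ and $[\mathcal F]^{n+1}=\mathcal F[[\mathcal F]^n]$. The Schreier families are $\mathcal S_0=\{\emptyset\}\cup\{\{m\}:m\in\mathbb N\}$, $\mathcal S_1=\{\emptyset\}\cup\{F:|F|\le\min F\}$, $\mathcal S_{\alpha+1}=\mathcal S_1[\mathcal S_\alpha]$, and, for a countable limit ordinal $\alpha$, $\mathcal S_\alpha=\{F: F\in\mathcal S_{\alpha_m}\text{ and } F\ge m\text{ for some }m\in\mathbb N\}$, where $\alpha_m\uparrow\alpha$ ($\alpha_m<\alpha$) is a fixed sequence, chosen arbitrarily. Put $[\mathcal F]^0=\mathcal S_0$. Spaces are real. A block basis $(x_i)$ of a sequence $(e_i)$ consists of nonzero finite linear combinations of the $e_i$ with successive supports. Nonzero vectors $u_1,\dots,u_k$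 in the linear span of a basic sequence $(x_i)$ whose supports with respect to $(x_i)$ satisfy $\operatorname{supp}u_1<\dots<\operatorname{supp}u_k$ are $\mathcal F$-admissible with respect to $(x_i)$ if $\{\min\operatorname{supp}u_1,\dots,\min\operatorname{supp}u_k\}\in\mathcal F$. For an equivalent norm $p$ on $[x_i]$ (the closed linear span), let $\delta_{\mathcal F}((x_i),p)$ be the supremum of all $\delta\ge0$ such that $p\big(\sum_{s=1}^k u_s\big)\ge\delta\sum_{s=1}^k p(u_s)$ for all $(u_s)_1^k$ that are $\mathcal F$-admissible with respect to $(x_i)$. Write $\delta_\alpha=\delta_{\mathcal S_\alpha}$, and omit $p$ when it is the given norm. **Theorem.** Let $Y$ be a Banach space with a basis $(y_i)$, let $\alpha<\omega_1$ and $n\in\mathbb N$, and let $\theta\ge0$ be given by $\theta^n=\delta_{[\mathcal S_\alpha]^n}(y_i)$. 1. For every $\varepsilon>0$ there are a block basis $(x_i)$ of $(y_i)$ and an equivalent norm $|||\cdot|||$ on $[x_i]$ with $\delta_\alpha((x_i),|||\cdot|||)\ge\theta-\varepsilon$. 2. Suppose that $(y_i)$ is bimonotone, that is, $\|Ey\|\le\|y\|$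 for all $y\in Y$ and all finite intervals $E\subset\mathbb N$, where $Ey$ is the restriction of $y$ to the coordinates in $E$. For $0\le j<n$ and $y\in Y$ let $$|y|_j=\sup\Big\{\theta^j\sum_{i=1}^{\ell}\|E_iy\| \;:\; E_1<\dots<E_\ell \text{ adjacent intervals of }\mathbb N,\ (E_iy)_{i=1}^{\ell}\ [\mathcal S_\alpha]^j\text{-admissible with respect to }(y_i)\Big\}$$ (with $0^0=1$). Then $$|||y|||=\frac1n\sum_{j=0}^{n-1}|y|_j$$ is an equivalent norm on $Y$, $(y_i)$ is bimonotone for $|||\cdot|||$, and $\delta_\alpha((y_i),|||\cdot|||)\ge\theta$. -/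

import Mathlib

open scoped Ordinal

noncomputable section

namespace AsymptoticL1

/-! Bases, block bases and families of finite sets are indexed by `ℕ = {0, 1, 2, …}`, as in
Mathlib's `SchauderBasis`. The index `i` stands for the `(i+1)`-st element when positive integers
are used for indexing; this shift is visible only in `schreierOne` and at limit stages of
`schreier`, where a set `F ⊆ ℕ` represents `{i + 1 : i ∈ F}`. -/

/-- `E i < E j` for `i < j`: every element of `E i` is smaller than every element of `E j`. -/
def Successive {ι : Type*} [LT ι] (E : ι → Finset ℕ) : Prop :=
  ∀ i j, i < j → ∀ a ∈ E i, ∀ b ∈ E j, a < b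

/-- The set of minima `{min E₁, …, min E_k}` (for nonempty `E i`, `sInf` is the minimum). -/
def minima {k : ℕ} (E : Fin k → Finset ℕ) : Finset ℕ :=
  Finset.univ.image fun i => sInf (E i : Set ℕ)

/-- Nonempty finite sets `E₁ < ⋯ < E_k` are `F`-admissible if `(min E_i)` belongs to `F`. -/
def IsAdmissible (F : Set (Finset ℕ)) {k : ℕ} (E : Fin k → Finset ℕ) : Prop :=
  (∀ i, (E i).Nonempty) ∧ Successive E ∧ minima E ∈ F

/-- The family `F[G]` of all unions `G₁ ∪ ⋯ ∪ G_k` of `F`-admissible sets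
`G₁ < ⋯ < G_k` from `G`. -/
def bracket (F G : Set (Finset ℕ)) : Set (Finset ℕ) :=
  {B | ∃ (k : ℕ) (E : Fin k → Finset ℕ),
    (∀ i, E i ∈ G) ∧ IsAdmissible F E ∧ B = Finset.univ.biUnion E}

/-- `S₀`: the singletons and the empty set. -/
def schreierZero : Set (Finset ℕ) := {F | F = ∅ ∨ ∃ m, F = {m}}

/-- `S₁`: the empty set and the sets `F` with `|F| ≤ min F`, where `m ∈ F` stands for the positive
integer `m + 1`. -/
def schreierOne : Set (Finset ℕ) := {F | ∀ m ∈ F, F.card ≤ m + 1}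

/-- For every countable limit ordinal `l` the sequence `c l 0 ≤ c l 1 ≤ ⋯` increases to `l`. -/
def IsLadder (c : Ordinal.{0} → ℕ → Ordinal.{0}) : Prop :=
  ∀ l < ω₁, Order.IsSuccLimit l →
    Monotone (c l) ∧ (∀ n, c l n < l) ∧ ∀ b < l, ∃ n, b < c l n

/-- The Schreier families, for the sequences `c l n ↑ l` chosen at limit ordinals `l`:
`S_{α+1} = S₁[S_α]`, and `S_l = {F : F ∈ S_{c l n} and F ≥ n for some n}`
(`n` here stands for the positive integer `n + 1`, like the elements of `F`). -/
def schreier (c : Ordinal.{0} → ℕ → Ordinal.{0}) (α : Ordinal.{0}) : Set (Finset ℕ) :=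
  Ordinal.limitRecOn α schreierZero (fun _ S => bracket schreierOne S)
    (fun l _ S => {F | ∃ (n : ℕ) (h : c l n < l), F ∈ S (c l n) h ∧ ∀ m ∈ F, n ≤ m})

/-- `[F]^0 = S₀`, `[F]^1 = F` and `[F]^{n+1} = F[[F]^n]`. -/
def famPow (F : Set (Finset ℕ)) : ℕ → Set (Finset ℕ)
  | 0 => schreierZero
  | 1 => F
  | n + 2 => bracket F (famPow F (n + 1))

/-- `(x_i)` is a block basis of `(e_i)`: nonzero finite linear combinations of the `e_i` with
successive supports. -/
def IsBlockBasis {X : Type*} [AddCommGroup X] [Module ℝ X] (e x : ℕ → X) : Prop :=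
  ∃ a : ℕ → (ℕ →₀ ℝ), (∀ i, a i ≠ 0) ∧ Successive (fun i => (a i).support) ∧
    ∀ i, x i = Finsupp.linearCombination ℝ e (a i)

/-- The constant `δ_F((x_i), p)` with respect to a norm `p`: the supremum of all `δ ≥ 0` with
`p (∑ y_i) ≥ δ ∑ p (y_i)` for all finite block sequences `(y_i)` of `(x_i)` that are
`F`-admissible with respect to `(x_i)`. The `y_i` are given by their coefficients. -/
def asymConst {X : Type*} [AddCommGroup X] [Module ℝ X] (F : Set (Finset ℕ)) (x : ℕ → X)
    (p : X → ℝ) : ℝ :=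
  sSup {δ : ℝ | 0 ≤ δ ∧ ∀ (k : ℕ) (a : Fin k → (ℕ →₀ ℝ)),
    IsAdmissible F (fun i => (a i).support) →
      δ * ∑ i, p (Finsupp.linearCombination ℝ x (a i)) ≤
        p (∑ i, Finsupp.linearCombination ℝ x (a i))}

/-- `p` is an equivalent norm on `X`. -/
def IsEquivalentNorm {X : Type*} [NormedAddCommGroup X] [NormedSpace ℝ X]
    (p : Seminorm ℝ X) : Prop :=
  ∃ c C : ℝ, 0 < c ∧ 0 < C ∧ ∀ x, c * ‖x‖ ≤ p x ∧ p x ≤ C * ‖x‖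

/-- The closed linear span `[x_i]`. -/
def closedSpan {X : Type*} [NormedAddCommGroup X] [NormedSpace ℝ X] (x : ℕ → X) :
    Submodule ℝ X :=
  (Submodule.span ℝ (Set.range x)).topologicalClosure

/-- The sequence `(x_i)` as a sequence in `[x_i]`. -/
def toClosedSpan {X : Type*} [NormedAddCommGroup X] [NormedSpace ℝ X] (x : ℕ → X) (i : ℕ) :
    closedSpan x :=
  ⟨x i, Submodule.le_topologicalClosure _ (Submodule.subset_span ⟨i, rfl⟩)⟩

section Basis

variable {Y : Type*} [NormedAddCommGroup Y] [NormedSpace ℝ Y]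

/-- The basis is bimonotone for the norm `p`: `p (E y) ≤ p y` for all `y` and all intervals
`E = [a, b)`. -/
def IsBimonotone (e : SchauderBasis ℝ Y) (p : Y → ℝ) : Prop :=
  ∀ (a b : ℕ) (y : Y), p (GeneralSchauderBasis.proj e (Finset.Ico a b) y) ≤ p y

/-- The support of `E y` with respect to the basis, for a finite set `E`. -/
def suppOn (e : SchauderBasis ℝ Y) (E : Finset ℕ) (y : Y) : Finset ℕ :=
  {i ∈ E | e.coord i y ≠ 0}

/-- `sup {w ∑_{i ≤ l} ‖E_i y‖}` over all adjacent intervals `E₁ < ⋯ < E_l` such that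
`(E_i y)` is `F`-admissible. The intervals are `E_i = [t i, t (i+1))`. -/
def layerNorm (e : SchauderBasis ℝ Y) (F : Set (Finset ℕ)) (w : ℝ) (y : Y) : ℝ :=
  sSup {r : ℝ | ∃ (l : ℕ) (t : ℕ → ℕ), StrictMono t ∧
    IsAdmissible F (fun i : Fin l => suppOn e (Finset.Ico (t i) (t (i + 1))) y) ∧
    r = w * ∑ i : Fin l, ‖GeneralSchauderBasis.proj e (Finset.Ico (t i) (t (i + 1))) y‖}

/-- The average `(1/n) ∑_{j < n} |y|_j`, where
`|y|_j = sup {θ^j ∑ ‖E_i y‖ : (E_i y) is [F]^j-admissible, (E_i) adjacent intervals}`. -/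
def averagedNorm (e : SchauderBasis ℝ Y) (F : Set (Finset ℕ)) (θ : ℝ) (n : ℕ) (y : Y) : ℝ :=
  (1 / (n : ℝ)) * ∑ j ∈ Finset.range n, layerNorm e (famPow F j) (θ ^ j) y

end Basis

end AsymptoticL1

end

noncomputable section

namespace AsymptoticL1

open Finset

/-! Write `F` for `S_α`. Suppose the norm `q` is bimonotone and satisfies the lower estimate with
constant `θ^n` on `[F]^n`-admissible blocks. Let `u_s` be `F`-admissible with sum `v`. If each `u_s`
is split `[F]^j`-admissibly, the pieces together form an `[F]^(j+1)`-admissible splitting of `v`,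
because `[F]^(j+1) = F[[F]^j]`. Hence `θ ∑ |u_s|_j ≤ |v|_{j+1}` for `j + 1 < n`. For `j = n - 1` the
hypothesis itself gives `θ ∑ |u_s|_{n-1} ≤ q v = |v|_0`. Adding up, the layers are permuted
cyclically and the average satisfies the lower estimate with constant `θ`. It is equivalent to `q`:
the layer `|·|_0` is `q`, and `[F]^j ⊆ [F]^n` bounds `|·|_j` by a multiple of `q` when `θ > 0`,
while the layers with `j ≥ 1` vanish when `θ = 0`. This is `exists_averaged_seminorm`. It needs only
a biorthogonal system, bimonotonicity, and that `q` is determined by initial segments, so it applies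
both to the basis and to a subsequence in its closed span.

For a general basis, `q` is first replaced by the supremum `Q` of the norms of interval
restrictions, which is bimonotone and equivalent. To keep the constant `θ^n`, pass to a sparse
subsequence. If `[A, B)` almost attains `Q (u_s)`, cut `u_s` into the parts before, in and after
`[A, B)`. This replaces each minimum by at most three later points, and for `α ≠ 0` the family
`[F]^n` absorbs this once the subsequence is sparse enough (`exists_absorbsThickenings_schreier`,
`LowerEstimate.comp_of_absorbsThickenings`). The case `α = 0` is trivial, as only one block is ever
involved. In this way part 1 holds even with `θ` in place of `θ - ε`.

Splittings are encoded by a set `M` of cut points and an end `N` (`blockSum`). No admissibility is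
then required of the pieces: by bimonotonicity the cuts can be moved into the support without
decreasing the sum (`exists_blockSum_le`). -/

/-! ### Hereditary and spreading families -/

/-- `G` absorbs `K`-fold thickenings beyond `g`: if each `m ∈ M ∈ G` is replaced by at most `K`
elements that are at least `g m`, keeping the order, then the resulting set belongs to `G`.
For `K = 1` and `g = id` this says that `G` is hereditary and spreading. -/
def AbsorbsThickenings (G : Set (Finset ℕ)) (K : ℕ) (g : ℕ → ℕ) : Prop :=
  ∀ M ∈ G, ∀ H : ℕ → Finset ℕ,
    (∀ m ∈ M, ∀ m' ∈ M, m < m' → ∀ a ∈ H m, ∀ b ∈ H m', a < b) →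
    (∀ m ∈ M, (H m).card ≤ K) → (∀ m ∈ M, ∀ h ∈ H m, g m ≤ h) → M.biUnion H ∈ G

theorem sInf_mem_of_nonempty {E : Finset ℕ} (h : E.Nonempty) : sInf (E : Set ℕ) ∈ E :=
  Finset.mem_coe.1 (Nat.sInf_mem (by exact_mod_cast h))

theorem sInf_le_of_mem {E : Finset ℕ} {a : ℕ} (h : a ∈ E) : sInf (E : Set ℕ) ≤ a :=
  Nat.sInf_le (Finset.mem_coe.2 h)

theorem AbsorbsThickenings.biUnion_mem {G : Set (Finset ℕ)} {K : ℕ} {g : ℕ → ℕ}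
    (hG : AbsorbsThickenings G K g) {k : ℕ} {c : Fin k → ℕ} (hc : StrictMono c)
    (hcG : univ.image c ∈ G) {E : Fin k → Finset ℕ} (hE : Successive E)
    (hK : ∀ i, (E i).card ≤ K) (hg : ∀ i, ∀ a ∈ E i, g (c i) ≤ a) : univ.biUnion E ∈ G := by
  have hext : ∀ i, Function.extend c E (fun _ => ∅) (c i) = E i :=
    fun i => hc.injective.extend_apply _ _ _
  have h := hG _ hcG (Function.extend c E fun _ => ∅) ?_ ?_ ?_
  · have heq : (univ.image c).biUnion (Function.extend c E fun _ => ∅) = univ.biUnion E := by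
      rw [image_biUnion]
      exact biUnion_congr rfl fun i _ => hext i
    rwa [heq] at h
  · intro m hm m' hm' hlt
    obtain ⟨i, -, rfl⟩ := mem_image.1 hm
    obtain ⟨j, -, rfl⟩ := mem_image.1 hm'
    rw [hext, hext]
    exact hE i j (hc.lt_iff_lt.1 hlt)
  · intro m hm
    obtain ⟨i, -, rfl⟩ := mem_image.1 hm
    rw [hext]
    exact hK i
  · intro m hm
    obtain ⟨i, -, rfl⟩ := mem_image.1 hm
    rw [hext]
    exact hg i

theorem AbsorbsThickenings.subset {G : Set (Finset ℕ)} (hG : AbsorbsThickenings G 1 id)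
    {M M' : Finset ℕ} (hM : M ∈ G) (h : M' ⊆ M) : M' ∈ G := by
  have := hG M hM (fun m => if m ∈ M' then {m} else ∅) ?_ ?_ ?_
  · convert this
    ext a
    simp only [mem_biUnion]
    constructor
    · exact fun ha => ⟨a, h ha, by simp [ha]⟩
    · rintro ⟨m, -, hm⟩
      split_ifs at hm with h1
      · rwa [mem_singleton.1 hm]
      · simp at hm
  · intro m _ m' _ hlt a ha b hb
    split_ifs at ha hb <;> simp_all
  · intro m _
    by_cases h : m ∈ M' <;> simp [h]
  · intro m _ a ha
    by_cases h : m ∈ M' <;> simp_all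

theorem strictMono_sInf {k : ℕ} {E : Fin k → Finset ℕ} (hne : ∀ i, (E i).Nonempty)
    (hE : Successive E) : StrictMono fun i => sInf (E i : Set ℕ) :=
  fun i j hij => hE i j hij _ (sInf_mem_of_nonempty (hne i)) _ (sInf_mem_of_nonempty (hne j))

/-- In a bracket `F[G]` with `F` hereditary and spreading, it suffices that the minima dominate
the elements of a member of `F`; empty sets are allowed. -/
theorem mem_bracket_of_le {F G : Set (Finset ℕ)} (hF : AbsorbsThickenings F 1 id) {k : ℕ}
    {c : Fin k → ℕ} (hc : StrictMono c) (hcF : univ.image c ∈ F) {E : Fin k → Finset ℕ}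
    (hE : Successive E) (hEG : ∀ i, E i ∈ G) (hle : ∀ i, ∀ a ∈ E i, c i ≤ a) :
    univ.biUnion E ∈ bracket F G := by
  classical
  set I : Finset (Fin k) := univ.filter fun i => (E i).Nonempty with hI
  set o := I.orderEmbOfFin rfl with ho
  have hmem : ∀ i, (E i).Nonempty → ∃ j, o j = i := by
    intro i hi
    have : i ∈ Set.range o := by
      rw [ho, range_orderEmbOfFin]
      simpa [hI] using hi
    exact this
  have hne : ∀ j, (E (o j)).Nonempty := fun j => by
    have := I.orderEmbOfFin_mem rfl j
    exact (mem_filter.1 (hI.subset this)).2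
  refine ⟨I.card, fun j => E (o j), fun j => hEG _, ⟨hne, ?_, ?_⟩, ?_⟩
  · exact fun i j hij => hE _ _ (o.strictMono hij)
  -- Dropping the `c i` with `E i` empty and moving the others right to `min E i` is a thickening
  -- with `K = 1`.
  · have h := hF.biUnion_mem hc hcF
      (E := fun i => if (E i).Nonempty then {sInf (E i : Set ℕ)} else ∅) ?_ ?_ ?_
    · convert h
      ext a
      simp only [minima, mem_image, mem_univ, true_and, mem_biUnion]
      constructor
      · rintro ⟨j, rfl⟩
        exact ⟨o j, by simp [hne j]⟩
      · rintro ⟨i, hi⟩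
        split_ifs at hi with h1
        · obtain ⟨j, rfl⟩ := hmem i h1
          exact ⟨j, (mem_singleton.1 hi).symm⟩
        · simp at hi
    · intro i j hij a ha b hb
      dsimp only at ha hb
      split_ifs at ha hb with h1 h2
      · rw [mem_singleton] at ha hb
        subst ha hb
        exact hE i j hij _ (sInf_mem_of_nonempty h1) _ (sInf_mem_of_nonempty h2)
      all_goals simp_all
    · intro i
      by_cases h : (E i).Nonempty <;> simp [h]
    · intro i a ha
      split_ifs at ha with h1
      · rw [mem_singleton.1 ha]
        exact hle i _ (sInf_mem_of_nonempty h1)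
      · simp at ha
  · ext a
    simp only [mem_biUnion, mem_univ, true_and]
    constructor
    · rintro ⟨i, hi⟩
      obtain ⟨j, rfl⟩ := hmem i ⟨a, hi⟩
      exact ⟨j, hi⟩
    · rintro ⟨j, hj⟩
      exact ⟨_, hj⟩

/-- The thickening takes place inside each set from `G`. The number of these sets does not grow and,
since `m ≤ g m`, their minima only move right. So `F` need only be hereditary and spreading; the
factor `K` falls on `G` alone. -/
theorem AbsorbsThickenings.bracket {F G : Set (Finset ℕ)} {K : ℕ} {g : ℕ → ℕ}
    (hF : AbsorbsThickenings F 1 id) (hG : AbsorbsThickenings G K g) (hg : ∀ m, m ≤ g m) :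
    AbsorbsThickenings (bracket F G) K g := by
  rintro M ⟨k, E, hEG, ⟨hne, hE, hmin⟩, rfl⟩ H hH hK hle
  have hsub : ∀ i, ∀ m ∈ E i, m ∈ univ.biUnion E := fun i m hm => by
    rw [mem_biUnion]
    exact ⟨i, mem_univ _, hm⟩
  rw [biUnion_biUnion]
  refine mem_bracket_of_le hF (strictMono_sInf hne hE) hmin ?_ ?_ ?_
  · intro i j hij a ha b hb
    obtain ⟨m, hm, ha⟩ := Finset.mem_biUnion.1 ha
    obtain ⟨m', hm', hb⟩ := Finset.mem_biUnion.1 hb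
    exact hH m (hsub i m hm) m' (hsub j m' hm') (hE i j hij m hm m' hm') a ha b hb
  · intro i
    exact hG _ (hEG i) H (fun m hm m' hm' => hH m (hsub i m hm) m' (hsub i m' hm'))
      (fun m hm => hK m (hsub i m hm)) fun m hm => hle m (hsub i m hm)
  · intro i a ha
    obtain ⟨m, hm, ha⟩ := Finset.mem_biUnion.1 ha
    exact (sInf_le_of_mem hm).trans ((hg m).trans (hle m (hsub i m hm) a ha))

theorem AbsorbsThickenings.famPow_succ {F : Set (Finset ℕ)} {K : ℕ} {g : ℕ → ℕ}
    (hF : AbsorbsThickenings F 1 id) (hFK : AbsorbsThickenings F K g) (hg : ∀ m, m ≤ g m) (n : ℕ) :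
    AbsorbsThickenings (famPow F (n + 1)) K g := by
  induction n with
  | zero => exact hFK
  | succ n ih => exact hF.bracket ih hg

theorem absorbsThickenings_schreierZero : AbsorbsThickenings schreierZero 1 id := by
  rintro M hM H - hK -
  have hcard : (M.biUnion H).card ≤ 1 := by
    rcases hM with rfl | ⟨m, rfl⟩
    · simp
    · simpa using hK m (by simp)
  rcases Nat.le_one_iff_eq_zero_or_eq_one.1 hcard with h | h
  · exact Or.inl (card_eq_zero.1 h)
  · exact Or.inr (card_eq_one.1 h)

theorem absorbsThickenings_schreierOne {K : ℕ} {g : ℕ → ℕ} (hg : ∀ m, K * (m + 1) ≤ g m + 1) :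
    AbsorbsThickenings schreierOne K g := by
  intro M hM H _ hK hle a ha
  obtain ⟨m, hm, ha⟩ := Finset.mem_biUnion.1 ha
  calc (M.biUnion H).card ≤ M.card * K := card_biUnion_le_card_mul _ _ _ hK
    _ ≤ (m + 1) * K := Nat.mul_le_mul_right _ (hM m hm)
    _ ≤ g m + 1 := by rw [mul_comm]; exact hg m
    _ ≤ a + 1 := Nat.add_le_add_right (hle m hm a ha) 1

theorem AbsorbsThickenings.famPow {F : Set (Finset ℕ)} (hF : AbsorbsThickenings F 1 id) (n : ℕ) :
    AbsorbsThickenings (famPow F n) 1 id := by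
  cases n with
  | zero => exact absorbsThickenings_schreierZero
  | succ n => exact hF.famPow_succ hF (fun _ => le_rfl) n

theorem bracket_schreierZero_subset (F : Set (Finset ℕ)) : bracket F schreierZero ⊆ F := by
  rintro B ⟨k, E, hE, ⟨hne, -, hmin⟩, rfl⟩
  convert hmin
  ext a
  simp only [minima, mem_biUnion, mem_univ, true_and, mem_image]
  refine exists_congr fun i => ?_
  rcases hE i with h | ⟨m, h⟩
  · exact absurd h (hne i).ne_empty
  · simp [h, eq_comm]

theorem subset_bracket_schreierZero {F : Set (Finset ℕ)} (hF : AbsorbsThickenings F 1 id) :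
    F ⊆ bracket F schreierZero := by
  intro M hM
  have h := mem_bracket_of_le (G := schreierZero) hF (M.orderEmbOfFin rfl).strictMono
    (by rwa [image_orderEmbOfFin_univ]) (E := fun i => {M.orderEmbOfFin rfl i})
    (fun i j hij a ha b hb => by
      rw [mem_singleton] at ha hb
      subst ha hb
      exact (M.orderEmbOfFin rfl).strictMono hij)
    (fun i => Or.inr ⟨_, rfl⟩) (fun i a ha => (mem_singleton.1 ha).ge)
  have heq : (univ.biUnion fun i => {M.orderEmbOfFin rfl i}) = M := by
    rw [biUnion_singleton, image_orderEmbOfFin_univ]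
  rwa [heq] at h

/-- Makes the recursion uniform at `n = 0`, where `[F]^1` is `F` by definition and not `F[S₀]`. -/
theorem bracket_famPow_subset (F : Set (Finset ℕ)) (n : ℕ) :
    bracket F (famPow F n) ⊆ famPow F (n + 1) := by
  cases n with
  | zero => exact bracket_schreierZero_subset F
  | succ n => exact subset_rfl

theorem subset_bracket {F G : Set (Finset ℕ)} (hF : AbsorbsThickenings F 1 id)
    (hF1 : ∀ m, {m} ∈ F) : G ⊆ bracket F G := by
  intro M hM
  have h := mem_bracket_of_le (G := G) hF (k := 1) (c := fun _ => sInf (M : Set ℕ))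
    (Subsingleton.strictMono _) (by simpa using hF1 _) (E := fun _ => M)
    (fun i j hij => absurd hij (by simp [Subsingleton.elim i j]))
    (fun _ => hM) (fun _ a ha => sInf_le_of_mem ha)
  simpa using h

theorem monotone_famPow {F : Set (Finset ℕ)} (hF : AbsorbsThickenings F 1 id)
    (hF1 : ∀ m, {m} ∈ F) : Monotone (famPow F) :=
  monotone_nat_of_le_succ fun n => (subset_bracket hF hF1).trans (bracket_famPow_subset F n)

/-! ### The Schreier families -/

section Schreier

variable (c : Ordinal.{0} → ℕ → Ordinal.{0})

theorem schreier_zero : schreier c 0 = schreierZero := by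
  simp [schreier]

theorem schreier_add_one (α : Ordinal.{0}) :
    schreier c (α + 1) = bracket schreierOne (schreier c α) := by
  simp [schreier]

theorem mem_schreier_limit {l : Ordinal.{0}} (hl : Order.IsSuccLimit l) {M : Finset ℕ} :
    M ∈ schreier c l ↔ ∃ n, c l n < l ∧ M ∈ schreier c (c l n) ∧ ∀ m ∈ M, n ≤ m := by
  rw [schreier, Ordinal.limitRecOn_limit _ _ _ _ hl]
  simp only [Set.mem_ofPred_eq, exists_prop, schreier]

theorem absorbsThickenings_schreier (α : Ordinal.{0}) :
    AbsorbsThickenings (schreier c α) 1 id := by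
  induction α using Ordinal.limitRecOn with
  | zero => rw [schreier_zero]; exact absorbsThickenings_schreierZero
  | add_one α ih =>
    rw [schreier_add_one]
    exact (absorbsThickenings_schreierOne (by simp)).bracket ih fun _ => le_rfl
  | limit l hl ih =>
    intro M hM H hH hK hle
    obtain ⟨n, hn, hM, hnM⟩ := (mem_schreier_limit c hl).1 hM
    refine (mem_schreier_limit c hl).2 ⟨n, hn, ih _ hn M hM H hH hK hle, fun a ha => ?_⟩
    obtain ⟨m, hm, ha⟩ := Finset.mem_biUnion.1 ha
    exact (hnM m hm).trans (hle m hm a ha)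

variable {c}

theorem singleton_mem_schreier (hc : IsLadder c) {α : Ordinal.{0}} (hα : α < ω₁) (m : ℕ) :
    {m} ∈ schreier c α := by
  induction α using Ordinal.limitRecOn with
  | zero => rw [schreier_zero]; exact Or.inr ⟨m, rfl⟩
  | add_one α ih =>
    rw [schreier_add_one]
    exact subset_bracket (absorbsThickenings_schreierOne (by simp)) (by simp [schreierOne])
      (ih ((lt_add_one α).trans hα))
  | limit l hl ih =>
    have hlt := (hc l hα hl).2.1 0
    exact (mem_schreier_limit c hl).2 ⟨0, hlt, ih _ hlt (hlt.trans hα), by simp⟩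

/-- `S₁` tolerates `K` times as many elements if they lie `K` times further out, and brackets
inherit this. `S₀` does not for `K > 1`, so the induction really starts at `S₁[S₀] = S₁`. -/
theorem exists_absorbsThickenings_schreier (hc : IsLadder c) (K : ℕ) {α : Ordinal.{0}}
    (hα : α < ω₁) (h0 : α ≠ 0) :
    ∃ g : ℕ → ℕ, (∀ m, m ≤ g m) ∧ AbsorbsThickenings (schreier c α) K g := by
  induction α using Ordinal.limitRecOn with
  | zero => exact absurd rfl h0
  | add_one α ih =>
    have hα' : α < ω₁ := (lt_add_one α).trans hα
    have h1 : AbsorbsThickenings schreierOne 1 id := absorbsThickenings_schreierOne (by simp)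
    rw [schreier_add_one]
    rcases eq_or_ne α 0 with rfl | hne
    · refine ⟨fun m => (K + 1) * (m + 1), fun m => by nlinarith, ?_⟩
      have heq : bracket schreierOne (schreier c 0) = schreierOne := by
        rw [schreier_zero]
        exact (bracket_schreierZero_subset _).antisymm (subset_bracket_schreierZero h1)
      rw [heq]
      exact absorbsThickenings_schreierOne fun m => by nlinarith
    · obtain ⟨g, hg, hG⟩ := ih hα' hne
      exact ⟨g, hg, h1.bracket hG hg⟩
  | limit l hl ih =>
    obtain ⟨-, hlt, hcof⟩ := hc l hα hl
    obtain ⟨n₀, hn₀⟩ := hcof 0 (pos_iff_ne_zero.2 h0)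
    have hex : ∀ n, ∃ g : ℕ → ℕ, c l n ≠ 0 →
        (∀ m, m ≤ g m) ∧ AbsorbsThickenings (schreier c (c l n)) K g := by
      intro n
      by_cases hn : c l n = 0
      · exact ⟨id, fun h => absurd hn h⟩
      · obtain ⟨g, hg⟩ := ih _ (hlt n) ((hlt n).trans hα) hn
        exact ⟨g, fun _ => hg⟩
    choose g hg using hex
    have hgle : ∀ {n m}, n ≤ m → g n m ≤ ∑ i ∈ range (m + 1), g i m := fun {n m} hnm =>
      single_le_sum (f := fun i => g i m) (fun _ _ => Nat.zero_le _) (by simpa using by omega)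
    -- A set taken from `S_{c l n}` has all elements `m ≥ n`, so the sum over indices up to `m`
    -- dominates `g n m`. The terms with `n₀` serve the levels `c l n = 0`: there the set has at
    -- most one element and is moved to the nonzero level `c l n₀`, which also requires elements `≥
    -- n₀`.
    refine ⟨fun m => m + n₀ + g n₀ m + ∑ n ∈ range (m + 1), g n m, fun m => by dsimp only; omega, ?_⟩
    intro M hM H hH hK hle
    dsimp only at hle
    obtain ⟨n, hn, hM, hnM⟩ := (mem_schreier_limit c hl).1 hM
    rw [mem_schreier_limit c hl]
    by_cases hn0 : c l n = 0
    · have hM0 : M ∈ schreier c (c l n₀) := by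
        rw [hn0, schreier_zero] at hM
        rcases hM with rfl | ⟨m, rfl⟩
        · exact (absorbsThickenings_schreier c _).subset
            (singleton_mem_schreier hc ((hlt n₀).trans hα) 0) (empty_subset _)
        · exact singleton_mem_schreier hc ((hlt n₀).trans hα) m
      refine ⟨n₀, hlt n₀, (hg n₀ hn₀.ne').2 M hM0 H hH hK fun m hm a ha => ?_, fun a ha => ?_⟩
      · have := hle m hm a ha
        omega
      · obtain ⟨m, hm, ha⟩ := Finset.mem_biUnion.1 ha
        have := hle m hm a ha
        omega
    · refine ⟨n, hn, (hg n hn0).2 M hM H hH hK fun m hm a ha => ?_, fun a ha => ?_⟩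
      · have := hle m hm a ha
        have := hgle (hnM m hm)
        omega
      · obtain ⟨m, hm, ha⟩ := Finset.mem_biUnion.1 ha
        have := hle m hm a ha
        have := hnM m hm
        omega

end Schreier

/-! ### Coordinate projections of a biorthogonal system -/

section CoordProj

variable {X : Type*} [AddCommGroup X] [Module ℝ X]

/-- The functionals `f i` are biorthogonal to the vectors `e i`. -/
def Biorthogonal (e : ℕ → X) (f : ℕ → X →ₗ[ℝ] ℝ) : Prop :=
  ∀ i j, f i (e j) = if i = j then 1 else 0

/-- The restriction of a vector to the coordinates in `E`. -/
def coordProj (e : ℕ → X) (f : ℕ → X →ₗ[ℝ] ℝ) (E : Finset ℕ) : X →ₗ[ℝ] X :=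
  ∑ i ∈ E, (f i).smulRight (e i)

variable {e : ℕ → X} {f : ℕ → X →ₗ[ℝ] ℝ}

theorem coordProj_apply (E : Finset ℕ) (v : X) : coordProj e f E v = ∑ i ∈ E, f i v • e i := by
  simp [coordProj]

theorem coordProj_congr {I J : Finset ℕ} {u v : X}
    (h : ∀ i, (if i ∈ I then f i u else 0) = if i ∈ J then f i v else 0) :
    coordProj e f I u = coordProj e f J v := by
  have key : ∀ (E : Finset ℕ) (w : X), E ⊆ I ∪ J →
      coordProj e f E w = ∑ i ∈ I ∪ J, (if i ∈ E then f i w else 0) • e i := by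
    intro E w hE
    rw [coordProj_apply]
    refine sum_subset_zero_on_sdiff hE (fun i hi => ?_) fun i hi => by rw [if_pos hi]
    rw [if_neg (mem_sdiff.1 hi).2, zero_smul]
  rw [key I u subset_union_left, key J v subset_union_right]
  exact sum_congr rfl fun i _ => by rw [h]

theorem Biorthogonal.apply_coordProj (hef : Biorthogonal e f) (E : Finset ℕ) (j : ℕ) (v : X) :
    f j (coordProj e f E v) = if j ∈ E then f j v else 0 := by
  rw [coordProj_apply, map_sum]
  simp [hef j]

theorem Biorthogonal.coordProj_coordProj (hef : Biorthogonal e f) (I J : Finset ℕ) (v : X) :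
    coordProj e f I (coordProj e f J v) = coordProj e f (I ∩ J) v := by
  refine coordProj_congr fun i => ?_
  rw [hef.apply_coordProj]
  by_cases hI : i ∈ I <;> by_cases hJ : i ∈ J <;> simp [hI, hJ]

theorem Biorthogonal.apply_linearCombination (hef : Biorthogonal e f) (a : ℕ →₀ ℝ) (j : ℕ) :
    f j (Finsupp.linearCombination ℝ e a) = a j := by
  rw [Finsupp.linearCombination_apply, Finsupp.sum, map_sum]
  simp +contextual [hef j, eq_comm]

/-- The coefficients of a vector on a finite set. -/
def coeffOn (f : ℕ → X →ₗ[ℝ] ℝ) (E : Finset ℕ) (v : X) : ℕ →₀ ℝ :=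
  Finsupp.onFinset E (fun j => if j ∈ E then f j v else 0) fun j hj => by
    by_contra h
    exact hj (if_neg h)

theorem mem_support_coeffOn {E : Finset ℕ} {v : X} {j : ℕ} :
    j ∈ (coeffOn f E v).support ↔ j ∈ E ∧ f j v ≠ 0 := by
  simp [coeffOn]

theorem linearCombination_coeffOn (E : Finset ℕ) (v : X) :
    Finsupp.linearCombination ℝ e (coeffOn f E v) = coordProj e f E v := by
  rw [coordProj_apply, Finsupp.linearCombination_apply, Finsupp.sum_of_support_subset (s := E)]
  · exact sum_congr rfl fun i hi => by simp [coeffOn, hi]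
  · exact fun i hi => (mem_support_coeffOn.1 hi).1
  · simp

end CoordProj

/-! ### Sums of norms over consecutive blocks -/

/-- The first element of `M ∪ {N}` after `m`, where only `N` is allowed not to exceed `m`. -/
def nextCut (M : Finset ℕ) (N m : ℕ) : ℕ :=
  sInf (insert N (M.filter (m < ·)) : Finset ℕ)

theorem nextCut_le_right (M : Finset ℕ) (N m : ℕ) : nextCut M N m ≤ N :=
  sInf_le_of_mem (mem_insert_self _ _)

theorem nextCut_le {M : Finset ℕ} {N m x : ℕ} (hx : x ∈ M) (h : m < x) : nextCut M N m ≤ x :=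
  sInf_le_of_mem (mem_insert_of_mem (mem_filter.2 ⟨hx, h⟩))

theorem le_nextCut {M : Finset ℕ} {N m b : ℕ} (hN : b ≤ N) (h : ∀ x ∈ M, m < x → b ≤ x) :
    b ≤ nextCut M N m := by
  have hmem : nextCut M N m ∈ insert N (M.filter (m < ·)) :=
    sInf_mem_of_nonempty (insert_nonempty _ _)
  rcases mem_insert.1 hmem with h' | h'
  · rwa [h']
  · exact h _ (mem_filter.1 h').1 (mem_filter.1 h').2

theorem lt_nextCut {M : Finset ℕ} {N m : ℕ} (hN : m < N) : m < nextCut M N m :=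
  le_nextCut (b := m + 1) hN fun _ _ h => h

section BlockSum

variable {X : Type*} [AddCommGroup X] [Module ℝ X] (e : ℕ → X) (f : ℕ → X →ₗ[ℝ] ℝ)
  (q : Seminorm ℝ X)

/-- The sum of the norms of the blocks into which `M` cuts the restriction of `v` to
`[min M, N)`. -/
def blockSum (M : Finset ℕ) (N : ℕ) (v : X) : ℝ :=
  ∑ m ∈ M, q (coordProj e f (Ico m (nextCut M N m)) v)

/-- Restrictions to intervals do not increase the seminorm. -/
def BimonotoneSeminorm : Prop :=
  ∀ (a b : ℕ) (v : X), q (coordProj e f (Ico a b) v) ≤ q v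

/-- The lower estimate `p (∑ u_i) ≥ δ ∑ p (u_i)` for `G`-admissible blocks `u_i`. -/
def LowerEstimate (p : Seminorm ℝ X) (G : Set (Finset ℕ)) (δ : ℝ) : Prop :=
  ∀ (k : ℕ) (a : Fin k → (ℕ →₀ ℝ)), IsAdmissible G (fun i => (a i).support) →
    δ * ∑ i, p (Finsupp.linearCombination ℝ e (a i)) ≤
      p (∑ i, Finsupp.linearCombination ℝ e (a i))

variable {e f q}

theorem blockSum_nonneg (M : Finset ℕ) (N : ℕ) (v : X) : 0 ≤ blockSum e f q M N v :=
  sum_nonneg fun _ _ => apply_nonneg _ _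

theorem blockSum_add_le (M : Finset ℕ) (N : ℕ) (u v : X) :
    blockSum e f q M N (u + v) ≤ blockSum e f q M N u + blockSum e f q M N v := by
  rw [blockSum, blockSum, blockSum, ← sum_add_distrib]
  exact sum_le_sum fun m _ => by
    rw [map_add]
    exact map_add_le_add _ _ _

theorem blockSum_smul (M : Finset ℕ) (N : ℕ) (r : ℝ) (v : X) :
    blockSum e f q M N (r • v) = ‖r‖ * blockSum e f q M N v := by
  rw [blockSum, blockSum, mul_sum]
  exact sum_congr rfl fun m _ => by rw [map_smul, map_smul_eq_mul]

theorem BimonotoneSeminorm.mono (hef : Biorthogonal e f) (hq : BimonotoneSeminorm e f q)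
    {a b a' b' : ℕ} (ha : a' ≤ a) (hb : b ≤ b') (v : X) :
    q (coordProj e f (Ico a b) v) ≤ q (coordProj e f (Ico a' b') v) := by
  have h := hq a b (coordProj e f (Ico a' b') v)
  rwa [hef.coordProj_coordProj, inter_eq_left.2 (Ico_subset_Ico ha hb)] at h

theorem blockSum_coordProj_le (hef : Biorthogonal e f) (hq : BimonotoneSeminorm e f q)
    (M : Finset ℕ) (N a b : ℕ) (v : X) :
    blockSum e f q M N (coordProj e f (Ico a b) v) ≤ blockSum e f q M N v := by
  refine sum_le_sum fun m _ => ?_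
  have h := hq a b (coordProj e f (Ico m (nextCut M N m)) v)
  rwa [hef.coordProj_coordProj, inter_comm, ← hef.coordProj_coordProj] at h

/-- Each interval starts at its own cut and ends no later than the next one, so it lies in the block
of `M` starting there. -/
theorem BimonotoneSeminorm.sum_le_blockSum (hef : Biorthogonal e f)
    (hq : BimonotoneSeminorm e f q) {M : Finset ℕ} {N : ℕ} {ι : Type*} {s : Finset ι}
    {a b : ι → ℕ} (hinj : Set.InjOn a s) (ha : ∀ i ∈ s, a i ∈ M) (hN : ∀ i ∈ s, b i ≤ N)
    (hb : ∀ i ∈ s, ∀ x ∈ M, a i < x → b i ≤ x) (v : X) :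
    ∑ i ∈ s, q (coordProj e f (Ico (a i) (b i)) v) ≤ blockSum e f q M N v := by
  calc ∑ i ∈ s, q (coordProj e f (Ico (a i) (b i)) v)
      ≤ ∑ i ∈ s, q (coordProj e f (Ico (a i) (nextCut M N (a i))) v) :=
        sum_le_sum fun i hi => hq.mono hef le_rfl (le_nextCut (hN i hi) (hb i hi)) v
    _ = ∑ m ∈ s.image a, q (coordProj e f (Ico m (nextCut M N m)) v) :=
        (sum_image (f := fun m => q (coordProj e f (Ico m (nextCut M N m)) v)) hinj).symm
    _ ≤ blockSum e f q M N v :=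
        sum_le_sum_of_subset_of_nonneg (image_subset_iff.2 ha) fun _ _ _ => apply_nonneg _ _

/-- The cuts may be moved into the support of `v`. -/
theorem exists_blockSum_le (hef : Biorthogonal e f) (hq : BimonotoneSeminorm e f q)
    {G : Set (Finset ℕ)} (hG : AbsorbsThickenings G 1 id) {M : Finset ℕ} (hM : M ∈ G) (N : ℕ)
    (v : X) : ∃ M' ∈ G, (∀ m ∈ M', m < N ∧ f m v ≠ 0) ∧
      blockSum e f q M N v ≤ blockSum e f q M' N v := by
  classical
  set B : ℕ → Finset ℕ := fun m => (Ico m (nextCut M N m)).filter fun i => f i v ≠ 0 with hB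
  set μ : ℕ → ℕ := fun m => sInf (B m : Set ℕ) with hμ
  have hμB : ∀ {m}, (B m).Nonempty → m ≤ μ m ∧ μ m < nextCut M N m ∧ f (μ m) v ≠ 0 := by
    intro m hm
    obtain ⟨h1, h2⟩ := mem_filter.1 (sInf_mem_of_nonempty hm)
    exact ⟨(mem_Ico.1 h1).1, (mem_Ico.1 h1).2, h2⟩
  have hlt : ∀ {m m'}, (B m).Nonempty → (B m').Nonempty → m' ∈ M → m < m' →
      nextCut M N m ≤ μ m' := fun hm hm' hmem h => (nextCut_le hmem h).trans (hμB hm').1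
  set H : ℕ → Finset ℕ := fun m => if (B m).Nonempty then {μ m} else ∅ with hH
  have hHmem : ∀ {m a}, a ∈ H m ↔ (B m).Nonempty ∧ a = μ m := by
    intro m a
    by_cases h : (B m).Nonempty <;> simp [hH, h]
  refine ⟨M.biUnion H, hG M hM H ?_ ?_ ?_, ?_, ?_⟩
  · intro m hm m' hm' h a ha b hb
    obtain ⟨haB, rfl⟩ := hHmem.1 ha
    obtain ⟨hbB, rfl⟩ := hHmem.1 hb
    exact (hμB haB).2.1.trans_le (hlt haB hbB hm' h)
  · intro m _
    by_cases h : (B m).Nonempty <;> simp [hH, h]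
  · intro m _ a ha
    obtain ⟨haB, rfl⟩ := hHmem.1 ha
    exact (hμB haB).1
  · intro a ha
    obtain ⟨m, hm, ha⟩ := Finset.mem_biUnion.1 ha
    obtain ⟨haB, rfl⟩ := hHmem.1 ha
    exact ⟨(hμB haB).2.1.trans_le (nextCut_le_right _ _ _), (hμB haB).2.2⟩
  -- A block that misses the support contributes nothing; any other block may start at its first
  -- support point `μ m`. The next new cut comes no earlier than the old end, so the new blocks
  -- contain these intervals.
  · have hsum : blockSum e f q M N v =
        ∑ m ∈ M.filter fun m => (B m).Nonempty,
          q (coordProj e f (Ico (μ m) (nextCut M N m)) v) := by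
      rw [blockSum, sum_filter]
      refine sum_congr rfl fun m _ => ?_
      have hout : ∀ i ∈ Ico m (nextCut M N m), f i v ≠ 0 → i ∈ B m := fun i hi h =>
        mem_filter.2 ⟨hi, h⟩
      split_ifs with h
      · congr 1
        refine coordProj_congr fun i => ?_
        have h1 := (hμB h).1
        by_cases h0 : f i v = 0
        · simp [h0]
        · have : i ∈ Ico m (nextCut M N m) ↔ i ∈ Ico (μ m) (nextCut M N m) := by
            refine ⟨fun hi => ?_, fun hi => Ico_subset_Ico_left h1 hi⟩
            exact mem_Ico.2 ⟨sInf_le_of_mem (hout i hi h0), (mem_Ico.1 hi).2⟩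
          simp only [this]
      · rw [coordProj_apply, sum_eq_zero, map_zero]
        intro i hi
        by_contra h0
        exact h ⟨i, hout i hi fun h1 => h0 (by rw [h1, zero_smul])⟩
    rw [hsum]
    refine hq.sum_le_blockSum hef ?_ ?_ (fun _ _ => nextCut_le_right _ _ _) ?_ v
    · intro m hm m' hm' heq
      obtain ⟨hm, hmB⟩ := mem_filter.1 (mem_coe.1 hm)
      obtain ⟨hm', hmB'⟩ := mem_filter.1 (mem_coe.1 hm')
      rcases lt_trichotomy m m' with h | h | h
      · exact absurd heq ((hμB hmB).2.1.trans_le (hlt hmB hmB' hm' h)).ne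
      · exact h
      · exact absurd heq ((hμB hmB').2.1.trans_le (hlt hmB' hmB hm h)).ne'
    · intro m hm
      obtain ⟨hm, hmB⟩ := mem_filter.1 hm
      exact Finset.mem_biUnion.2 ⟨m, hm, hHmem.2 ⟨hmB, rfl⟩⟩
    · intro m hm x hx hmx
      obtain ⟨hm, hmB⟩ := mem_filter.1 hm
      obtain ⟨m', hm', hx⟩ := Finset.mem_biUnion.1 hx
      obtain ⟨hmB', rfl⟩ := hHmem.1 hx
      refine hlt hmB hmB' hm' ?_
      by_contra h
      rcases (not_lt.1 h).eq_or_lt with rfl | h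
      · exact lt_irrefl _ hmx
      · exact lt_asymm hmx ((hμB hmB').2.1.trans_le (hlt hmB' hmB hm h))

theorem apply_eq_zero_of_successive {k : ℕ} {a : Fin k → (ℕ →₀ ℝ)}
    (ha : Successive fun s => (a s).support) {s t : Fin k} (hst : t ≠ s) {x y i : ℕ}
    (hx : x ∈ (a s).support) (hy : y ∈ (a s).support) (hxi : x ≤ i) (hiy : i ≤ y) :
    a t i = 0 := by
  by_contra h
  have hi : i ∈ (a t).support := Finsupp.mem_support_iff.2 h
  rcases lt_or_gt_of_ne hst with h | h
  · exact absurd (ha t s h i hi x hx) hxi.not_gt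
  · exact absurd (ha s t h y hy i hi) hiy.not_gt

theorem Biorthogonal.apply_sum_linearCombination (hef : Biorthogonal e f) {k : ℕ}
    (a : Fin k → (ℕ →₀ ℝ)) (i : ℕ) :
    f i (∑ s, Finsupp.linearCombination ℝ e (a s)) = ∑ s, a s i := by
  rw [map_sum]
  exact sum_congr rfl fun s _ => hef.apply_linearCombination _ _

/-- Block sums of successive vectors are dominated by a block sum of the sum of the vectors. -/
theorem exists_sum_blockSum_le (hef : Biorthogonal e f) (hq : BimonotoneSeminorm e f q) {k : ℕ}
    {a : Fin k → (ℕ →₀ ℝ)} (ha : Successive fun s => (a s).support) {M : Fin k → Finset ℕ}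
    (hM : ∀ s, M s ⊆ (a s).support) (n : Fin k → ℕ) :
    ∃ N, ∑ s, blockSum e f q (M s) (n s) (Finsupp.linearCombination ℝ e (a s)) ≤
      blockSum e f q (univ.biUnion M) N (∑ s, Finsupp.linearCombination ℝ e (a s)) := by
  set v := ∑ s, Finsupp.linearCombination ℝ e (a s) with hv
  set β : Fin k → ℕ := fun s => (a s).support.sup id with hβ
  have hβmem : ∀ {s m}, m ∈ M s → β s ∈ (a s).support := by
    intro s m hm
    obtain ⟨i, hi, h⟩ := exists_mem_eq_sup _ ⟨m, hM s hm⟩ (id : ℕ → ℕ)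
    rw [hβ]
    dsimp only
    rw [h]
    exact hi
  have hleβ : ∀ {s i}, i ∈ (a s).support → i ≤ β s := fun {s i} hi => le_sup (f := id) hi
  -- One past every coordinate in use. Clipping the blocks of the `s`-th vector at `β s + 1` makes
  -- restricting it the same as restricting the whole sum `v`.
  refine ⟨univ.sup β + 1, ?_⟩
  calc ∑ s, blockSum e f q (M s) (n s) (Finsupp.linearCombination ℝ e (a s))
      = ∑ x ∈ univ.sigma M, q (coordProj e f (Ico x.2
          (min (nextCut (M x.1) (n x.1) x.2) (β x.1 + 1))) v) := by
        rw [sum_sigma]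
        refine sum_congr rfl fun s _ => sum_congr rfl fun m hm => ?_
        congr 1
        refine coordProj_congr fun i => ?_
        rw [hef.apply_linearCombination, hv, hef.apply_sum_linearCombination]
        by_cases hi : i ∈ Ico m (min (nextCut (M s) (n s) m) (β s + 1))
        · obtain ⟨hmi, hi'⟩ := mem_Ico.1 hi
          rw [lt_min_iff] at hi'
          rw [if_pos hi, if_pos (mem_Ico.2 ⟨hmi, hi'.1⟩), sum_eq_single s]
          · exact fun t _ hts => apply_eq_zero_of_successive ha hts (hM s hm) (hβmem hm) hmi
              (Nat.lt_succ_iff.1 hi'.2)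
          · simp
        · rw [if_neg hi]
          split_ifs with hi'
          · by_contra h0
            refine hi (mem_Ico.2 ⟨(mem_Ico.1 hi').1, lt_min (mem_Ico.1 hi').2 ?_⟩)
            exact Nat.lt_succ_iff.2 (hleβ (Finsupp.mem_support_iff.2 h0))
          · rfl
    _ ≤ _ := by
        refine hq.sum_le_blockSum hef ?_ ?_ ?_ ?_ v
        · rintro ⟨s, m⟩ hx ⟨t, m'⟩ hy heq
          have hx : m ∈ M s := by simpa using hx
          have hy : m' ∈ M t := by simpa using hy
          obtain rfl : m = m' := heq
          obtain rfl : s = t := by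
            by_contra hst
            exact Finsupp.mem_support_iff.1 (hM t hy)
              (apply_eq_zero_of_successive ha (Ne.symm hst) (hM s hx) (hM s hx) le_rfl le_rfl)
          rfl
        · rintro ⟨s, m⟩ hx
          exact Finset.mem_biUnion.2 ⟨s, mem_univ _, (mem_sigma.1 hx).2⟩
        · rintro ⟨s, m⟩ -
          exact (min_le_right _ _).trans (Nat.add_le_add_right (le_sup (f := β) (mem_univ s)) 1)
        · rintro ⟨s, m⟩ hx x hxM hlt
          have hm : m ∈ M s := (mem_sigma.1 hx).2
          obtain ⟨t, -, hxt⟩ := Finset.mem_biUnion.1 hxM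
          rcases lt_trichotomy s t with h | rfl | h
          · exact (min_le_right _ _).trans (ha s t h _ (hβmem hm) _ (hM t hxt))
          · exact (min_le_left _ _).trans (nextCut_le hxt hlt)
          · exact absurd (ha t s h _ (hM t hxt) _ (hM s hm)) hlt.not_gt

theorem sum_coordProj_nextCut {M : Finset ℕ} {N : ℕ} (hne : M.Nonempty)
    (v : X) : ∑ m ∈ M, coordProj e f (Ico m (nextCut M N m)) v =
      coordProj e f (Ico (sInf (M : Set ℕ)) N) v := by
  simp only [coordProj_apply]
  rw [← sum_biUnion]
  · refine sum_congr ?_ fun _ _ => rfl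
    ext i
    simp only [mem_biUnion, mem_Ico]
    constructor
    · rintro ⟨m, hm, h1, h2⟩
      exact ⟨(sInf_le_of_mem hm).trans h1, h2.trans_le (nextCut_le_right _ _ _)⟩
    · rintro ⟨h1, h2⟩
      -- The block containing `i` starts at the largest element of `M` not exceeding `i`.
      have hne' : (M.filter fun x => x ≤ i).Nonempty :=
        ⟨_, mem_filter.2 ⟨sInf_mem_of_nonempty hne, h1⟩⟩
      obtain ⟨hm, hmi⟩ := mem_filter.1 (max'_mem _ hne')
      refine ⟨_, hm, hmi, le_nextCut (b := i + 1) h2 fun x hx hlt => ?_⟩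
      by_contra h
      have hx' : x ∈ M.filter fun x => x ≤ i :=
        mem_filter.2 ⟨hx, Nat.lt_succ_iff.1 (not_le.1 h)⟩
      exact absurd (le_max' _ x hx') hlt.not_ge
  · intro m hm m' hm' hne
    have key : ∀ {m m'}, m' ∈ M → m < m' →
        Disjoint (Ico m (nextCut M N m)) (Ico m' (nextCut M N m')) := fun hm' h =>
      disjoint_left.2 fun i hi hi' => absurd ((mem_Ico.1 hi).2.trans_le (nextCut_le hm' h))
        (mem_Ico.1 hi').1.not_gt
    rcases lt_or_gt_of_ne hne with h | h
    · exact key hm' h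
    · exact (key hm h).symm

theorem sum_orderEmbOfFin {A : Type*} [AddCommMonoid A] (M : Finset ℕ) (g : ℕ → A) :
    ∑ i, g (M.orderEmbOfFin rfl i) = ∑ m ∈ M, g m := by
  have := sum_image (s := univ) (g := M.orderEmbOfFin rfl) (f := g)
    (M.orderEmbOfFin rfl).injective.injOn
  rw [image_orderEmbOfFin_univ] at this
  exact this.symm

/-- The lower estimate for admissible blocks in terms of block sums. -/
theorem LowerEstimate.mul_blockSum_le {G : Set (Finset ℕ)} {δ : ℝ} (hδ : LowerEstimate e q G δ)
    {M : Finset ℕ} (hM : M ∈ G) {N : ℕ} {v : X} (hMN : ∀ m ∈ M, m < N ∧ f m v ≠ 0) :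
    δ * blockSum e f q M N v ≤ q (coordProj e f (Ico (sInf (M : Set ℕ)) N) v) := by
  rcases M.eq_empty_or_nonempty with rfl | hne
  · simp [blockSum]
  set o := M.orderEmbOfFin rfl with ho
  have hoM : ∀ i, o i ∈ M := M.orderEmbOfFin_mem rfl
  set a : Fin M.card → (ℕ →₀ ℝ) := fun i => coeffOn f (Ico (o i) (nextCut M N (o i))) v with ha
  have hoa : ∀ i, o i ∈ (a i).support := fun i => mem_support_coeffOn.2
    ⟨mem_Ico.2 ⟨le_rfl, lt_nextCut (hMN _ (hoM i)).1⟩, (hMN _ (hoM i)).2⟩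
  have hIco : ∀ {i x}, x ∈ (a i).support → o i ≤ x ∧ x < nextCut M N (o i) := fun hx =>
    mem_Ico.1 (mem_support_coeffOn.1 hx).1
  have hadm : IsAdmissible G fun i => (a i).support := by
    refine ⟨fun i => ⟨_, hoa i⟩, fun i j hij x hx y hy => ?_, ?_⟩
    · exact (hIco hx).2.trans_le
        ((nextCut_le (hoM j) (o.strictMono hij)).trans (hIco hy).1)
    -- Each cut lies in the support of `v`, so it is the minimum of the support of its own block.
    · have : minima (fun i => (a i).support) = M := by
        refine Eq.trans ?_ (image_orderEmbOfFin_univ M rfl)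
        refine image_congr fun i _ => le_antisymm (sInf_le_of_mem (hoa i)) ?_
        exact (hIco (sInf_mem_of_nonempty ⟨_, hoa i⟩)).1
      rwa [this]
  have h := hδ _ a hadm
  simp only [ha, linearCombination_coeffOn] at h
  rw [sum_orderEmbOfFin M fun m => q (coordProj e f (Ico m (nextCut M N m)) v),
    sum_orderEmbOfFin M fun m => coordProj e f (Ico m (nextCut M N m)) v,
    sum_coordProj_nextCut hne] at h
  exact h

end BlockSum

/-! ### The norms given by suprema of block sums -/

/-- The near-maximisers for the different `i` can be chosen independently, with the error `ε` shared
among them; the `+ 1` covers empty `ι`. -/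
theorem sum_iSup_le {ι κ : Type*} [Fintype ι] [Nonempty κ] {g : ι → κ → ℝ} {r : ℝ}
    (h : ∀ c : ι → κ, ∑ i, g i (c i) ≤ r) : ∑ i, ⨆ j, g i j ≤ r := by
  refine le_of_forall_pos_le_add fun ε hε => ?_
  have hpos : 0 < ε / (Fintype.card ι + 1) := by positivity
  have hex : ∀ i, ∃ j, (⨆ j, g i j) - ε / (Fintype.card ι + 1) < g i j := fun i =>
    exists_lt_of_lt_ciSup (by linarith)
  choose c hc using hex
  calc ∑ i, ⨆ j, g i j ≤ ∑ i, (g i (c i) + ε / (Fintype.card ι + 1)) :=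
        sum_le_sum fun i _ => by linarith [hc i]
    _ = ∑ i, g i (c i) + Fintype.card ι * (ε / (Fintype.card ι + 1)) := by
        simp [sum_add_distrib]
    _ ≤ r + ε := by
        refine add_le_add (h c) ?_
        rw [mul_div_assoc', div_le_iff₀ (by positivity)]
        nlinarith

section BlockNorm

variable {X : Type*} [AddCommGroup X] [Module ℝ X] (e : ℕ → X) (f : ℕ → X →ₗ[ℝ] ℝ)
  (q : Seminorm ℝ X)

/-- The supremum of the weighted block sums with cuts in `G`. -/
def blockNorm (G : Set (Finset ℕ)) (w : ℝ) (v : X) : ℝ :=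
  ⨆ c : {M // M ∈ G} × ℕ, w * blockSum e f q c.1 c.2 v

/-- The weighted block sums with cuts in `G` are at most `C q`. -/
def BlockBounded (G : Set (Finset ℕ)) (w C : ℝ) : Prop :=
  ∀ M ∈ G, ∀ (N : ℕ) (v : X), w * blockSum e f q M N v ≤ C * q v

variable {e f q} {G : Set (Finset ℕ)} {w C : ℝ}

theorem blockNorm_le (hG : G.Nonempty) {v : X} {r : ℝ}
    (h : ∀ M ∈ G, ∀ N, w * blockSum e f q M N v ≤ r) : blockNorm e f q G w v ≤ r := by
  have := hG.to_subtype
  exact ciSup_le fun c => h c.1 c.1.2 c.2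

theorem BlockBounded.le_blockNorm (hb : BlockBounded e f q G w C) {M : Finset ℕ} (hM : M ∈ G)
    (N : ℕ) (v : X) : w * blockSum e f q M N v ≤ blockNorm e f q G w v := by
  -- Without a bound the real supremum would take the default value `0`.
  have hbdd : BddAbove (Set.range fun c : {M // M ∈ G} × ℕ => w * blockSum e f q c.1 c.2 v) := by
    refine ⟨C * q v, ?_⟩
    rintro _ ⟨c, rfl⟩
    exact hb c.1 c.1.2 c.2 v
  exact le_ciSup hbdd (⟨M, hM⟩, N)

theorem BlockBounded.blockNorm_add_le (hb : BlockBounded e f q G w C) (hG : G.Nonempty)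
    (hw : 0 ≤ w) (u v : X) :
    blockNorm e f q G w (u + v) ≤ blockNorm e f q G w u + blockNorm e f q G w v :=
  blockNorm_le hG fun M hM N => by
    calc w * blockSum e f q M N (u + v)
        ≤ w * (blockSum e f q M N u + blockSum e f q M N v) :=
          mul_le_mul_of_nonneg_left (blockSum_add_le M N u v) hw
      _ ≤ _ := by
          rw [mul_add]
          exact add_le_add (hb.le_blockNorm hM N u) (hb.le_blockNorm hM N v)

theorem blockNorm_smul (r : ℝ) (v : X) :
    blockNorm e f q G w (r • v) = ‖r‖ * blockNorm e f q G w v := by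
  rw [blockNorm, blockNorm, Real.mul_iSup_of_nonneg (norm_nonneg r)]
  exact iSup_congr fun c => by rw [blockSum_smul]; ring

theorem mul_blockNorm {r : ℝ} (hr : 0 ≤ r) (v : X) :
    r * blockNorm e f q G w v = blockNorm e f q G (r * w) v := by
  rw [blockNorm, blockNorm, Real.mul_iSup_of_nonneg hr]
  exact iSup_congr fun c => by ring

theorem BlockBounded.blockNorm_coordProj_le (hb : BlockBounded e f q G w C) (hG : G.Nonempty)
    (hw : 0 ≤ w) (hef : Biorthogonal e f) (hq : BimonotoneSeminorm e f q) (a b : ℕ) (v : X) :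
    blockNorm e f q G w (coordProj e f (Ico a b) v) ≤ blockNorm e f q G w v :=
  blockNorm_le hG fun M hM N =>
    (mul_le_mul_of_nonneg_left (blockSum_coordProj_le hef hq M N a b v) hw).trans
      (hb.le_blockNorm hM N v)

/-! ### The averaged norm -/

theorem blockBounded_schreierZero (hq : BimonotoneSeminorm e f q) :
    BlockBounded e f q schreierZero 1 1 := by
  intro M hM N v
  rw [one_mul, one_mul]
  rcases hM with rfl | ⟨m, rfl⟩
  · simp [blockSum]
  · simpa [blockSum] using hq _ _ v

/-- `q` is determined by the initial segments. -/
def DeterminedByInitialSegments (e : ℕ → X) (f : ℕ → X →ₗ[ℝ] ℝ) (q : Seminorm ℝ X) : Prop :=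
  ∀ (v : X) (r : ℝ), (∀ N, q (coordProj e f (Ico 0 N) v) ≤ r) → q v ≤ r

/-- The single cut `0` with end `N` produces the initial segment `[0, N)`. -/
theorem le_blockNorm_schreierZero (hq : BimonotoneSeminorm e f q)
    (hlim : DeterminedByInitialSegments e f q) (v : X) :
    q v ≤ blockNorm e f q schreierZero 1 v := by
  refine hlim v _ fun N => ?_
  have h := (blockBounded_schreierZero hq).le_blockNorm (Or.inr ⟨0, rfl⟩) N v
  have hcut : nextCut {0} N 0 = N :=
    le_antisymm (nextCut_le_right _ _ _) (le_nextCut le_rfl (by simp))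
  simpa [blockSum, hcut] using h

/-- Once the cuts lie in the support the blocks are admissible, and bimonotonicity removes the
truncation to `[min M', N)`. -/
theorem LowerEstimate.blockBounded (hef : Biorthogonal e f) (hq : BimonotoneSeminorm e f q)
    (hG : AbsorbsThickenings G 1 id) {δ : ℝ} (hδ0 : 0 ≤ δ) (hδ : LowerEstimate e q G δ) :
    BlockBounded e f q G δ 1 := by
  intro M hM N v
  obtain ⟨M', hM', hsupp, hle⟩ := exists_blockSum_le hef hq hG hM N v
  calc δ * blockSum e f q M N v ≤ δ * blockSum e f q M' N v := mul_le_mul_of_nonneg_left hle hδ0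
    _ ≤ q (coordProj e f (Ico (sInf (M' : Set ℕ)) N) v) := hδ.mul_blockSum_le hM' hsupp
    _ ≤ 1 * q v := by rw [one_mul]; exact hq _ _ v

theorem exists_blockBounded_famPow (hef : Biorthogonal e f) (hq : BimonotoneSeminorm e f q)
    {F : Set (Finset ℕ)} (hF : AbsorbsThickenings F 1 id) (hF1 : ∀ m, {m} ∈ F) {n : ℕ} {θ : ℝ}
    (hθ0 : 0 ≤ θ) (hθ : LowerEstimate e q (famPow F n) (θ ^ n)) {j : ℕ} (hj : j < n) :
    ∃ C, 0 ≤ C ∧ BlockBounded e f q (famPow F j) (θ ^ j) C := by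
  rcases eq_or_ne j 0 with rfl | hj0
  · exact ⟨1, zero_le_one, by rw [pow_zero]; exact blockBounded_schreierZero hq⟩
  rcases hθ0.eq_or_lt with rfl | hpos
  · exact ⟨0, le_rfl, fun M _ N v => by simp [zero_pow hj0]⟩
  refine ⟨θ ^ j / θ ^ n, by positivity, fun M hM N v => ?_⟩
  have h := hθ.blockBounded hef hq (hF.famPow n) (by positivity) M
    (monotone_famPow hF hF1 hj.le hM) N v
  rw [div_mul_eq_mul_div, le_div_iff₀ (by positivity), mul_assoc]
  refine mul_le_mul_of_nonneg_left ?_ (by positivity)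
  linarith

/-- The combinatorial core: with the cuts of each vector inside its support, their union is a union
of successive sets from `[F]^j` whose minima dominate a member of `F`, hence lies in `F[[F]^j]`. -/
theorem exists_mem_famPow_sum_blockSum_le (hef : Biorthogonal e f)
    (hq : BimonotoneSeminorm e f q) {F : Set (Finset ℕ)} (hF : AbsorbsThickenings F 1 id) (j : ℕ)
    {k : ℕ} {a : Fin k → (ℕ →₀ ℝ)} (ha : IsAdmissible F fun s => (a s).support)
    {M : Fin k → Finset ℕ} (hM : ∀ s, M s ∈ famPow F j) (N : Fin k → ℕ) :
    ∃ M' ∈ famPow F (j + 1), ∃ N',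
      ∑ s, blockSum e f q (M s) (N s) (Finsupp.linearCombination ℝ e (a s)) ≤
        blockSum e f q M' N' (∑ s, Finsupp.linearCombination ℝ e (a s)) := by
  obtain ⟨hne, hsucc, hmin⟩ := ha
  choose M' hM' hsupp hle using fun s => exists_blockSum_le hef hq (hF.famPow j) (hM s) (N s)
    (Finsupp.linearCombination ℝ e (a s))
  have hsub : ∀ s, M' s ⊆ (a s).support := fun s m hm => by
    have := (hsupp s m hm).2
    rw [hef.apply_linearCombination] at this
    exact Finsupp.mem_support_iff.2 this
  obtain ⟨N', hN'⟩ := exists_sum_blockSum_le (q := q) hef hq hsucc hsub N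
  refine ⟨_, bracket_famPow_subset F j (mem_bracket_of_le hF (strictMono_sInf hne hsucc) hmin
    (E := M') ?_ hM' ?_), N', (sum_le_sum fun s _ => hle s).trans hN'⟩
  · exact fun s t hst x hx z hz => hsucc s t hst x (hsub s hx) z (hsub t hz)
  · exact fun s x hx => sInf_le_of_mem (hsub s hx)

/-- The average of the norms given by iterated admissible blocks satisfies the lower
estimate. -/
theorem exists_averaged_seminorm (hef : Biorthogonal e f) (hq : BimonotoneSeminorm e f q)
    (hlim : DeterminedByInitialSegments e f q) {F : Set (Finset ℕ)}
    (hF : AbsorbsThickenings F 1 id) (hF1 : ∀ m, {m} ∈ F) {n : ℕ} (hn : 1 ≤ n) {θ : ℝ}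
    (hθ0 : 0 ≤ θ) (hθ : LowerEstimate e q (famPow F n) (θ ^ n)) :
    ∃ p : Seminorm ℝ X,
      (∀ v, p v = (1 / (n : ℝ)) *
        ∑ j ∈ range n, blockNorm e f q (famPow F j) (θ ^ j) v) ∧
      (∃ c C : ℝ, 0 < c ∧ 0 < C ∧ ∀ v, c * q v ≤ p v ∧ p v ≤ C * q v) ∧
      BimonotoneSeminorm e f p ∧ LowerEstimate e p F θ := by
  have hn0 : (0 : ℝ) < n := by exact_mod_cast hn
  have hne : ∀ j, (famPow F j).Nonempty := fun j =>
    ⟨∅, monotone_famPow hF hF1 (Nat.zero_le j) (Or.inl rfl)⟩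
  have hbd : ∀ j ∈ range n, ∃ C, 0 ≤ C ∧ BlockBounded e f q (famPow F j) (θ ^ j) C :=
    fun j hj => exists_blockBounded_famPow hef hq hF hF1 hθ0 hθ (mem_range.1 hj)
  have hpow : ∀ j, 0 ≤ θ ^ j := fun j => pow_nonneg hθ0 j
  choose! C hC0 hC using hbd
  let p : Seminorm ℝ X := Seminorm.of
    (fun v => (1 / (n : ℝ)) * ∑ j ∈ range n, blockNorm e f q (famPow F j) (θ ^ j) v)
    (fun u v => by
      rw [← mul_add, ← sum_add_distrib]
      exact mul_le_mul_of_nonneg_left (sum_le_sum fun j hj =>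
        (hC j hj).blockNorm_add_le (hne j) (hpow j) u v) (by positivity))
    (fun r v => by
      simp only [blockNorm_smul, ← mul_sum]
      ring)
  have hp : ∀ v, p v = (1 / (n : ℝ)) *
      ∑ j ∈ range n, blockNorm e f q (famPow F j) (θ ^ j) v := fun v => rfl
  have hqle : ∀ v, q v ≤ blockNorm e f q (famPow F 0) (θ ^ 0) v := fun v => by
    rw [pow_zero]
    exact le_blockNorm_schreierZero hq hlim v
  have hnonneg : ∀ j ∈ range n, ∀ v, 0 ≤ blockNorm e f q (famPow F j) (θ ^ j) v := by
    intro j hj v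
    obtain ⟨M, hM⟩ := hne j
    exact (mul_nonneg (hpow j) (blockSum_nonneg M 0 v)).trans ((hC j hj).le_blockNorm hM 0 v)
  refine ⟨p, hp, ⟨1 / n, (1 / n) * ∑ j ∈ range n, C j + 1, by positivity, ?_, fun v => ?_⟩, ?_, ?_⟩
  · have := sum_nonneg hC0
    positivity
  · constructor
    · rw [hp]
      refine mul_le_mul_of_nonneg_left ?_ (by positivity)
      exact (hqle v).trans (single_le_sum (f := fun j => blockNorm e f q (famPow F j) (θ ^ j) v)
        (fun j hj => hnonneg j hj v) (mem_range.2 hn))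
    · rw [hp, add_mul, mul_assoc, sum_mul]
      have h1 : ∑ j ∈ range n, blockNorm e f q (famPow F j) (θ ^ j) v ≤
          ∑ j ∈ range n, C j * q v :=
        sum_le_sum fun j hj => blockNorm_le (hne j) fun M hM N => hC j hj M hM N v
      have h2 := mul_le_mul_of_nonneg_left h1 (by positivity : (0 : ℝ) ≤ 1 / n)
      have h3 : 0 ≤ 1 * q v := by rw [one_mul]; exact apply_nonneg q v
      linarith
  · intro a b v
    rw [hp, hp]
    exact mul_le_mul_of_nonneg_left (sum_le_sum fun j hj =>
      (hC j hj).blockNorm_coordProj_le (hne j) (hpow j) hef hq a b v) (by positivity)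
  · intro k a ha
    set v := ∑ s, Finsupp.linearCombination ℝ e (a s) with hv
    -- Stated with a free bound `r`, since it is used with `r = |v|_{j+1}` below the top layer and
    -- with `r = q v` at the top.
    have hstep : ∀ j r, (∀ M ∈ famPow F (j + 1), ∀ N, θ ^ (j + 1) * blockSum e f q M N v ≤ r) →
        θ * ∑ s, blockNorm e f q (famPow F j) (θ ^ j) (Finsupp.linearCombination ℝ e (a s)) ≤
          r := by
      intro j r hr
      have := (hne j).to_subtype
      simp only [mul_sum, mul_blockNorm hθ0, ← pow_succ']
      refine sum_iSup_le fun c => ?_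
      obtain ⟨M, hM, N, hle⟩ := exists_mem_famPow_sum_blockSum_le (q := q) hef hq hF j ha
        (fun s => (c s).1.2) fun s => (c s).2
      rw [← mul_sum]
      exact (mul_le_mul_of_nonneg_left hle (hpow _)).trans (hr M hM N)
    obtain ⟨n, rfl⟩ := Nat.exists_eq_add_of_le' hn
    simp only [hp]
    rw [← mul_sum, mul_left_comm, sum_comm, mul_sum]
    refine mul_le_mul_of_nonneg_left ?_ (by positivity)
    -- Cyclic matching: layer `j` of the blocks goes with layer `j + 1` of `v`, the top layer with
    -- layer `0`.
    rw [sum_range_succ, sum_range_succ']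
    refine add_le_add (sum_le_sum fun j hj => hstep j _ fun M hM N => ?_) ?_
    · exact (hC (j + 1) (by simpa using hj)).le_blockNorm hM N v
    · refine (hstep n (q v) fun M hM N => ?_).trans (hqle v)
      have := hθ.blockBounded hef hq (hF.famPow _) (hpow _) M hM N v
      rwa [one_mul] at this

end BlockNorm

/-! ### The asymptotic constants -/

section AsymConst

variable {X : Type*} [AddCommGroup X] [Module ℝ X] {e : ℕ → X} {p : Seminorm ℝ X}
  {F : Set (Finset ℕ)}

/-- The supremum is attained, since each inequality is a closed condition on `δ`. -/
theorem lowerEstimate_asymConst (F : Set (Finset ℕ)) (e : ℕ → X) (p : Seminorm ℝ X) :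
    LowerEstimate e p F (asymConst F e p) := by
  intro k a ha
  rcases (sum_nonneg fun i (_ : i ∈ univ) =>
    apply_nonneg p (Finsupp.linearCombination ℝ e (a i))).eq_or_lt with h | h
  · rw [← h, mul_zero]
    exact apply_nonneg _ _
  · rw [← le_div_iff₀ h]
    refine csSup_le ⟨0, le_rfl, fun _ _ _ => by rw [zero_mul]; exact apply_nonneg _ _⟩ ?_
    rintro δ ⟨-, hδ⟩
    exact (le_div_iff₀ h).2 (hδ k a ha)

/-- Test on the single block `e m`. This keeps the supremum defining `asymConst` bounded. -/
theorem LowerEstimate.le_one {m : ℕ} (hm : {m} ∈ F) (hp : 0 < p (e m)) {δ : ℝ}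
    (hδ : LowerEstimate e p F δ) : δ ≤ 1 := by
  have h := hδ 1 (fun _ => Finsupp.single m 1) ⟨?_, ?_, ?_⟩
  · simpa [hp] using h
  · simp
  · exact fun i j hij => absurd hij (by simp [Subsingleton.elim i j])
  · simpa [minima, Finsupp.support_single] using hm

theorem LowerEstimate.le_asymConst {m : ℕ} (hm : {m} ∈ F) (hp : 0 < p (e m)) {δ : ℝ}
    (hδ0 : 0 ≤ δ) (hδ : LowerEstimate e p F δ) : δ ≤ asymConst F e p :=
  le_csSup ⟨1, fun _ hr => LowerEstimate.le_one hm hp hr.2⟩ ⟨hδ0, hδ⟩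

theorem lowerEstimate_schreierZero : LowerEstimate e p schreierZero 1 := by
  intro k a ha
  have hk : k ≤ 1 := by
    have hcard : (minima fun i => (a i).support).card = k := by
      rw [minima, card_image_of_injective _ (strictMono_sInf ha.1 ha.2.1).injective, card_univ,
        Fintype.card_fin]
    rcases ha.2.2 with h | ⟨m, h⟩
    · rw [h] at hcard
      simp [← hcard]
    · rw [h] at hcard
      simp [← hcard]
  interval_cases k <;> simp

end AsymConst

/-! ### Passing to a subsequence -/

section Thickening

variable {X : Type*} [AddCommGroup X] [Module ℝ X] {e : ℕ → X} {f : ℕ → X →ₗ[ℝ] ℝ}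
  {q Q : Seminorm ℝ X}

theorem coordProj_linearCombination (hef : Biorthogonal e f) {E : Finset ℕ} {a : ℕ →₀ ℝ}
    (ha : a.support ⊆ E) :
    coordProj e f E (Finsupp.linearCombination ℝ e a) = Finsupp.linearCombination ℝ e a := by
  simp only [coordProj_apply, hef.apply_linearCombination]
  rw [Finsupp.linearCombination_apply, Finsupp.sum_of_support_subset _ ha]
  simp

/-- The set of the minimum of `S`, or the empty set. -/
def minSet (S : Finset ℕ) : Finset ℕ := if S.Nonempty then {sInf (S : Set ℕ)} else ∅

theorem mem_minSet {S : Finset ℕ} {a : ℕ} :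
    a ∈ minSet S ↔ S.Nonempty ∧ a = sInf (S : Set ℕ) := by
  by_cases h : S.Nonempty <;> simp [minSet, h]

theorem sInf_mem_minSet {S : Finset ℕ} {a : ℕ} (ha : a ∈ S) : sInf (S : Set ℕ) ∈ minSet S :=
  mem_minSet.2 ⟨⟨a, ha⟩, rfl⟩

theorem minSet_subset (S : Finset ℕ) : minSet S ⊆ S := fun a ha => by
  obtain ⟨h, rfl⟩ := mem_minSet.1 ha
  exact sInf_mem_of_nonempty h

theorem card_minSet_le (S : Finset ℕ) : (minSet S).card ≤ 1 := by
  by_cases h : S.Nonempty <;> simp [minSet, h]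

/-- The minima of the three parts of `S` before, in and after `[A, B)`. -/
def partMinima (S : Finset ℕ) (A B : ℕ) : Finset ℕ :=
  minSet (S.filter fun i => i < A) ∪ minSet (S.filter fun i => A ≤ i ∧ i < B) ∪
    minSet (S.filter fun i => A ≤ i ∧ B ≤ i)

theorem partMinima_subset (S : Finset ℕ) (A B : ℕ) : partMinima S A B ⊆ S :=
  union_subset (union_subset ((minSet_subset _).trans (filter_subset _ _))
    ((minSet_subset _).trans (filter_subset _ _))) ((minSet_subset _).trans (filter_subset _ _))

theorem card_partMinima_le (S : Finset ℕ) (A B : ℕ) : (partMinima S A B).card ≤ 3 :=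
  (card_union_le _ _).trans (Nat.add_le_add ((card_union_le _ _).trans
    (Nat.add_le_add (card_minSet_le _) (card_minSet_le _))) (card_minSet_le _))

/-- The three parts partition `S`, even when `B < A`. Having `min S` among the cuts separates each
block from the preceding one. -/
theorem sInf_mem_partMinima {S : Finset ℕ} (hS : S.Nonempty) (A B : ℕ) :
    sInf (S : Set ℕ) ∈ partMinima S A B := by
  have hmin := sInf_mem_of_nonempty hS
  have key : ∀ T ⊆ S, sInf (S : Set ℕ) ∈ T → sInf (S : Set ℕ) ∈ minSet T := fun T hT h =>
    mem_minSet.2 ⟨⟨_, h⟩, le_antisymm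
      (sInf_le_of_mem (hT (sInf_mem_of_nonempty ⟨_, h⟩))) (sInf_le_of_mem h)⟩
  simp only [partMinima, mem_union]
  rcases lt_or_ge (sInf (S : Set ℕ)) A with h | h
  · exact Or.inl (Or.inl (key _ (filter_subset _ _) (mem_filter.2 ⟨hmin, h⟩)))
  rcases lt_or_ge (sInf (S : Set ℕ)) B with h' | h'
  · exact Or.inl (Or.inr (key _ (filter_subset _ _) (mem_filter.2 ⟨hmin, h, h'⟩)))
  · exact Or.inr (key _ (filter_subset _ _) (mem_filter.2 ⟨hmin, h, h'⟩))

/-- Splitting every block into three parts, the lower estimate extends to interval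
restrictions of the blocks. -/
theorem LowerEstimate.mul_sum_coordProj_le (hef : Biorthogonal e f) {G : Set (Finset ℕ)} {δ : ℝ}
    (hδ0 : 0 ≤ δ) (hδ : LowerEstimate e q G δ) {k : ℕ} {b : Fin k → (ℕ →₀ ℝ)}
    (hne : ∀ s, (b s).support.Nonempty) (hb : Successive fun s => (b s).support)
    {A B : Fin k → ℕ} (hG : univ.biUnion (fun s => partMinima (b s).support (A s) (B s)) ∈ G) :
    δ * ∑ s, q (coordProj e f (Ico (A s) (B s)) (Finsupp.linearCombination ℝ e (b s))) ≤
      q (∑ s, Finsupp.linearCombination ℝ e (b s)) := by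
  set v := ∑ s, Finsupp.linearCombination ℝ e (b s) with hv
  set M := univ.biUnion fun s => partMinima (b s).support (A s) (B s) with hM
  have hMmem : ∀ {s x}, x ∈ partMinima (b s).support (A s) (B s) → x ∈ M := fun {s x} hx =>
    mem_biUnion.2 ⟨s, mem_univ _, hx⟩
  have hMsupp : ∀ {x}, x ∈ M → ∃ s, x ∈ (b s).support := fun {x} hx => by
    obtain ⟨s, -, hs⟩ := mem_biUnion.1 hx
    exact ⟨s, partMinima_subset _ _ _ hs⟩
  set N := (univ.biUnion fun s => (b s).support).sup id + 1 with hN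
  have hltN : ∀ {s x}, x ∈ (b s).support → x < N := fun {s x} hx =>
    Nat.lt_succ_iff.2 (le_sup (f := id) (mem_biUnion.2 ⟨s, mem_univ _, hx⟩))
  have hfv : ∀ i, f i v = ∑ s, b s i := hef.apply_sum_linearCombination b
  have hfv_mem : ∀ {s i}, i ∈ (b s).support → f i v = b s i := fun {s i} hi => by
    rw [hfv]
    exact sum_eq_single s (fun t _ hts => apply_eq_zero_of_successive hb hts hi hi le_rfl le_rfl)
      (by simp)
  have hlow := hδ.mul_blockSum_le hG (N := N) (v := v) fun m hm => by
    obtain ⟨s, hs⟩ := hMsupp hm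
    exact ⟨hltN hs, by rw [hfv_mem hs]; exact Finsupp.mem_support_iff.1 hs⟩
  have hv' : coordProj e f (Ico (sInf (M : Set ℕ)) N) v = v := by
    rw [hv, map_sum]
    refine sum_congr rfl fun s _ => coordProj_linearCombination hef fun i hi => mem_Ico.2 ⟨?_, ?_⟩
    · exact (sInf_le_of_mem (hMmem (sInf_mem_partMinima (hne s) _ _))).trans (sInf_le_of_mem hi)
    · exact hltN hi
  rw [hv'] at hlow
  refine (mul_le_mul_of_nonneg_left ?_ hδ0).trans hlow
  set S : Fin k → Finset ℕ := fun s =>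
    (b s).support.filter fun i => A s ≤ i ∧ i < B s with hS
  set h : Fin k → ℕ := fun s => sInf (S s : Set ℕ) with hh
  have hhS : ∀ {s}, (S s).Nonempty → h s ∈ (b s).support ∧ A s ≤ h s ∧ h s < B s := fun hs =>
    mem_filter.1 (sInf_mem_of_nonempty hs)
  have hhM : ∀ {s}, (S s).Nonempty → h s ∈ M := fun {s} hs =>
    hMmem (mem_union_left _ (mem_union_right _ (mem_minSet.2 ⟨hs, rfl⟩)))
  have hzero : ∀ s ∈ univ, s ∉ univ.filter (fun s => (S s).Nonempty) →
      q (coordProj e f (Ico (A s) (B s)) (Finsupp.linearCombination ℝ e (b s))) = 0 := by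
    intro s _ hs
    rw [coordProj_apply, sum_eq_zero, map_zero]
    intro i hi
    rw [hef.apply_linearCombination]
    by_contra h0
    refine hs (mem_filter.2 ⟨mem_univ _, i, mem_filter.2 ⟨?_, mem_Ico.1 hi⟩⟩)
    exact Finsupp.mem_support_iff.2 fun h1 => h0 (by rw [h1, zero_smul])
  rw [← sum_subset (filter_subset (fun s => (S s).Nonempty) univ) hzero]
  -- The cut after `h s` is the minimum of the third part of `b s`, or else of the next block, or
  -- `N`; so the block of `v` starting at `h s` is exactly the middle part of `b s`.
  have hblock : ∀ s, (S s).Nonempty →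
      coordProj e f (Ico (A s) (B s)) (Finsupp.linearCombination ℝ e (b s)) =
        coordProj e f (Ico (h s) (nextCut M N (h s))) v := by
    intro s hs
    obtain ⟨hsb, hAs, hsB⟩ := hhS hs
    refine coordProj_congr fun i => ?_
    rw [hef.apply_linearCombination]
    by_cases hi : i ∈ Ico (h s) (nextCut M N (h s))
    · obtain ⟨hi1, hi2⟩ := mem_Ico.1 hi
      have hval : f i v = b s i := by
        rw [hfv]
        refine sum_eq_single s (fun t _ hts => ?_) (by simp)
        by_contra h0
        have hit : i ∈ (b t).support := Finsupp.mem_support_iff.2 h0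
        rcases lt_or_gt_of_ne hts with hlt | hlt
        · exact absurd (hb t s hlt i hit _ hsb) hi1.not_gt
        · have hcut : nextCut M N (h s) ≤ sInf ((b t).support : Set ℕ) :=
            nextCut_le (hMmem (sInf_mem_partMinima (hne t) _ _))
              (hb s t hlt _ hsb _ (sInf_mem_of_nonempty (hne t)))
          exact absurd hi2 (hcut.trans (sInf_le_of_mem hit)).not_gt
      rw [if_pos hi, hval]
      split_ifs with hAB
      · rfl
      · by_contra h0
        have hBi : B s ≤ i := by
          by_contra hlt
          exact hAB (mem_Ico.2 ⟨hAs.trans hi1, not_le.1 hlt⟩)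
        have hi3 : i ∈ (b s).support.filter fun i => A s ≤ i ∧ B s ≤ i :=
          mem_filter.2 ⟨Finsupp.mem_support_iff.2 (Ne.symm h0), hAs.trans hi1, hBi⟩
        have hmin := (mem_filter.1 (sInf_mem_of_nonempty ⟨i, hi3⟩)).2.2
        have hcut := nextCut_le (N := N) (hMmem (mem_union_right _ (sInf_mem_minSet hi3)))
          (hsB.trans_le hmin)
        exact absurd hi2 (hcut.trans (sInf_le_of_mem hi3)).not_gt
    · rw [if_neg hi]
      split_ifs with hAB
      · by_contra h0
        have his : i ∈ (b s).support := Finsupp.mem_support_iff.2 h0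
        obtain ⟨hA, hB⟩ := mem_Ico.1 hAB
        refine hi (mem_Ico.2 ⟨sInf_le_of_mem (mem_filter.2 ⟨his, hA, hB⟩),
          le_nextCut (b := i + 1) (hltN his) fun x hx hlt => ?_⟩)
        obtain ⟨t, -, hxt⟩ := mem_biUnion.1 hx
        rcases lt_trichotomy t s with hts | rfl | hts
        · exact absurd (hb t s hts _ (partMinima_subset _ _ _ hxt) _ hsb) hlt.not_gt
        · simp only [partMinima, mem_union] at hxt
          rcases hxt with (hxt | hxt) | hxt
          · have := (mem_filter.1 (minSet_subset _ hxt)).2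
            omega
          · exact absurd (mem_minSet.1 hxt).2 hlt.ne'
          · have := (mem_filter.1 (minSet_subset _ hxt)).2.2
            omega
        · exact hb s t hts _ his _ (partMinima_subset _ _ _ hxt)
      · rfl
  calc ∑ s ∈ univ.filter fun s => (S s).Nonempty,
        q (coordProj e f (Ico (A s) (B s)) (Finsupp.linearCombination ℝ e (b s)))
      = ∑ s ∈ univ.filter fun s => (S s).Nonempty,
        q (coordProj e f (Ico (h s) (nextCut M N (h s))) v) :=
        sum_congr rfl fun s hs => by rw [hblock s (mem_filter.1 hs).2]
    _ = ∑ m ∈ (univ.filter fun s => (S s).Nonempty).image h,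
        q (coordProj e f (Ico m (nextCut M N m)) v) := by
        refine (sum_image
          (f := fun m => q (coordProj e f (Ico m (nextCut M N m)) v)) ?_).symm
        intro s hs t ht heq
        have hs' := hhS (mem_filter.1 (mem_coe.1 hs)).2
        have ht' := hhS (mem_filter.1 (mem_coe.1 ht)).2
        rcases lt_trichotomy s t with hst | hst | hst
        · exact absurd heq (hb s t hst _ hs'.1 _ ht'.1).ne
        · exact hst
        · exact absurd heq (hb t s hst _ ht'.1 _ hs'.1).ne'
    _ ≤ blockSum e f q M N v := by
        refine sum_le_sum_of_subset_of_nonneg (image_subset_iff.2 fun s hs => ?_)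
          fun _ _ _ => apply_nonneg _ _
        exact hhM (mem_filter.1 hs).2

/-- The lower estimate passes to sufficiently sparse subsequences and to the supremum of the
seminorms of interval restrictions. -/
theorem LowerEstimate.comp_of_absorbsThickenings (hef : Biorthogonal e f) {G : Set (Finset ℕ)}
    {δ : ℝ} (hδ0 : 0 ≤ δ) (hδ : LowerEstimate e q G δ) {g ν : ℕ → ℕ}
    (hG : AbsorbsThickenings G 3 g) (hν : StrictMono ν) (hg : ∀ i, g i ≤ ν i)
    (hQ : ∀ v, Q v = ⨆ c : ℕ × ℕ, q (coordProj e f (Ico c.1 c.2) v)) (hqQ : ∀ v, q v ≤ Q v) :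
    LowerEstimate (e ∘ ν) Q G δ := by
  rintro k a ⟨hne, hsucc, hmin⟩
  refine le_trans ?_ (hqQ _)
  set b : Fin k → (ℕ →₀ ℝ) := fun s => (a s).mapDomain ν with hb
  have hlc : ∀ s, Finsupp.linearCombination ℝ (e ∘ ν) (a s) =
      Finsupp.linearCombination ℝ e (b s) := fun s =>
    (Finsupp.linearCombination_mapDomain ℝ ν (a s)).symm
  have hsupp : ∀ s, (b s).support = (a s).support.image ν := fun s =>
    Finsupp.mapDomain_support_of_injective hν.injective _
  have hbsucc : Successive fun s => (b s).support := by
    intro s t hst x hx y hy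
    simp only [hsupp, mem_image] at hx hy
    obtain ⟨i, hi, rfl⟩ := hx
    obtain ⟨j, hj, rfl⟩ := hy
    exact hν (hsucc s t hst i hi j hj)
  simp only [hlc, hQ, mul_sum, Real.mul_iSup_of_nonneg hδ0]
  refine sum_iSup_le fun c => ?_
  rw [← mul_sum]
  refine hδ.mul_sum_coordProj_le hef hδ0 (fun s => ?_) hbsucc ?_
  · rw [hsupp]
    exact (hne s).image ν
  -- The minimum `m` of the `s`-th support, an index of the subsequence, is replaced by at most
  -- three indices of the basis, all at least `ν m ≥ g m`.
  · refine hG.biUnion_mem (strictMono_sInf hne hsucc) hmin ?_ (fun s => card_partMinima_le _ _ _) ?_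
    · exact fun s t hst x hx y hy =>
        hbsucc s t hst x (partMinima_subset _ _ _ hx) y (partMinima_subset _ _ _ hy)
    · intro s x hx
      have hx' := partMinima_subset _ _ _ hx
      rw [hsupp] at hx'
      obtain ⟨i, hi, rfl⟩ := mem_image.1 hx'
      exact (hg _).trans (hν.monotone (sInf_le_of_mem hi))

end Thickening

/-! ### Schauder bases -/

section Schauder

variable {Y : Type*} [NormedAddCommGroup Y] [NormedSpace ℝ Y] (y : SchauderBasis ℝ Y)

/-- The coordinate functionals of a basis as linear maps. -/
def coordMap (i : ℕ) : Y →ₗ[ℝ] ℝ := (y.coord i : Y →ₗ[ℝ] ℝ)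

theorem biorthogonal_coordMap : Biorthogonal y (coordMap y) := fun i j => by
  simp [coordMap, y.ortho, Pi.single_apply]

theorem proj_eq_coordProj (E : Finset ℕ) (v : Y) :
    GeneralSchauderBasis.proj y E v = coordProj y (coordMap y) E v := by
  rw [GeneralSchauderBasis.proj_apply, coordProj_apply]
  rfl

theorem norm_basis_pos (i : ℕ) : 0 < ‖y i‖ :=
  norm_pos_iff.2 ((GeneralSchauderBasis.linearIndependent y).ne_zero i)

theorem tendsto_coordProj_Ico (v : Y) :
    Filter.Tendsto (fun N => coordProj y (coordMap y) (Ico 0 N) v) Filter.atTop (nhds v) := by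
  refine (SchauderBasis.tendsto_proj y v).congr fun N => ?_
  rw [← proj_eq_coordProj, SchauderBasis.proj, range_eq_Ico]

theorem determinedByInitialSegments_norm :
    DeterminedByInitialSegments y (coordMap y) (normSeminorm ℝ Y) := fun v _ h =>
  le_of_tendsto' (tendsto_coordProj_Ico y v).norm h

variable {y}

/-- Admissible adjacent intervals are cut at the minima of their supports; conversely, cuts moved
into the support of `v` are the left endpoints of admissible adjacent intervals. -/
theorem layerNorm_eq_blockNorm (hq : BimonotoneSeminorm y (coordMap y) (normSeminorm ℝ Y))
    {G : Set (Finset ℕ)} (hG : AbsorbsThickenings G 1 id) (hG0 : ∅ ∈ G) {w C : ℝ} (hw : 0 ≤ w)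
    (hb : BlockBounded y (coordMap y) (normSeminorm ℝ Y) G w C) (v : Y) :
    layerNorm y G w v = blockNorm y (coordMap y) (normSeminorm ℝ Y) G w v := by
  have hef := biorthogonal_coordMap y
  have hsupp : ∀ {a b i : ℕ}, i ∈ suppOn y (Ico a b) v ↔ (a ≤ i ∧ i < b) ∧ coordMap y i v ≠ 0 := by
    intro a b i
    rw [suppOn, mem_filter, mem_Ico]
    rfl
  have hle : ∀ r, (∃ (l : ℕ) (t : ℕ → ℕ), StrictMono t ∧
      IsAdmissible G (fun i : Fin l => suppOn y (Ico (t i) (t (i + 1))) v) ∧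
      r = w * ∑ i : Fin l, ‖GeneralSchauderBasis.proj y (Ico (t i) (t (i + 1))) v‖) →
      r ≤ blockNorm y (coordMap y) (normSeminorm ℝ Y) G w v := by
    rintro r ⟨l, t, ht, ⟨hne, hsucc, hmin⟩, rfl⟩
    refine le_trans (mul_le_mul_of_nonneg_left ?_ hw) (hb.le_blockNorm hmin (t l) v)
    set μ : Fin l → ℕ := fun i => sInf (suppOn y (Ico (t i) (t (i + 1))) v : Set ℕ) with hμ
    have hμmem : ∀ i : Fin l, (t i ≤ μ i ∧ μ i < t (i + 1)) ∧ coordMap y (μ i) v ≠ 0 := fun i =>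
      hsupp.1 (sInf_mem_of_nonempty (hne i))
    have hμmono : StrictMono μ := strictMono_sInf hne hsucc
    calc ∑ i : Fin l, ‖GeneralSchauderBasis.proj y (Ico (t i) (t (i + 1))) v‖
        = ∑ i : Fin l, normSeminorm ℝ Y
            (coordProj y (coordMap y) (Ico (μ i) (t (i + 1))) v) := by
          refine sum_congr rfl fun i _ => ?_
          rw [proj_eq_coordProj, coe_normSeminorm]
          congr 1
          refine coordProj_congr fun j => ?_
          by_cases h0 : coordMap y j v = 0
          · simp [h0]
          · have : j ∈ Ico (t i) (t (i + 1)) ↔ j ∈ Ico (μ i) (t (i + 1)) := by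
              refine ⟨fun hj => ?_, fun hj => Ico_subset_Ico_left (hμmem i).1.1 hj⟩
              exact mem_Ico.2 ⟨sInf_le_of_mem (hsupp.2 ⟨mem_Ico.1 hj, h0⟩), (mem_Ico.1 hj).2⟩
            simp only [this]
      _ ≤ _ := by
          refine hq.sum_le_blockSum hef (s := univ) (a := μ) (b := fun i : Fin l => t (i + 1))
            hμmono.injective.injOn (fun i _ => mem_image_of_mem μ (mem_univ i))
            (fun i _ => ht.monotone i.2) ?_ v
          intro i _ x hx hlt
          obtain ⟨j, -, rfl⟩ := mem_image.1 hx
          have hij : i < j := hμmono.lt_iff_lt.1 hlt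
          exact (ht.monotone (Nat.succ_le_of_lt hij)).trans (hμmem j).1.1
  refine le_antisymm (csSup_le ⟨0, 0, id, strictMono_id, ⟨fun i => i.elim0,
    fun i => i.elim0, by simpa [minima] using hG0⟩, by simp⟩ hle) ?_
  refine blockNorm_le ⟨∅, hG0⟩ fun M hM N => ?_
  obtain ⟨M', hM', hMN, hMM'⟩ := exists_blockSum_le hef hq hG hM N v
  refine (mul_le_mul_of_nonneg_left hMM' hw).trans ?_
  set o := M'.orderEmbOfFin rfl with ho
  have hoM : ∀ i, o i ∈ M' := M'.orderEmbOfFin_mem rfl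
  -- Beyond the elements of `M'`, all below `N`, any strictly increasing continuation that starts at
  -- or after `N` will do; the last interval can only grow.
  set t : ℕ → ℕ := fun i => if h : i < M'.card then o ⟨i, h⟩ else N + i with ht
  have hto : ∀ i : Fin M'.card, t i = o i := fun i => by simp [ht]
  have htmono : StrictMono t := by
    refine strictMono_nat_of_lt_succ fun i => ?_
    simp only [ht]
    split_ifs with h1 h2
    · exact o.strictMono (by simp)
    · have := (hMN _ (hoM ⟨i, h1⟩)).1
      omega
    · omega
    · omega
  have hot : ∀ i : Fin M'.card, o i ∈ suppOn y (Ico (t i) (t (i + 1))) v := fun i =>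
    hsupp.2 ⟨⟨(hto i).le, by rw [← hto]; exact htmono (Nat.lt_succ_self _)⟩, (hMN _ (hoM i)).2⟩
  refine le_trans (mul_le_mul_of_nonneg_left ?_ hw)
    (le_csSup ⟨_, fun r hr => hle r hr⟩ ⟨M'.card, t, htmono, ⟨fun i => ⟨_, hot i⟩, ?_, ?_⟩, rfl⟩)
  · rw [blockSum, ← sum_orderEmbOfFin M' fun m =>
      normSeminorm ℝ Y (coordProj y (coordMap y) (Ico m (nextCut M' N m)) v)]
    refine sum_le_sum fun i _ => ?_
    rw [proj_eq_coordProj, ← ho, hto]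
    refine hq.mono hef le_rfl ?_ v
    by_cases h : (i : ℕ) + 1 < M'.card
    · have heq : t (i + 1) = o ⟨i + 1, h⟩ := hto ⟨i + 1, h⟩
      rw [heq]
      exact nextCut_le (hoM _) (o.strictMono (Fin.lt_def.2 (Nat.lt_succ_self _)))
    · refine (nextCut_le_right _ _ _).trans ?_
      simp [ht, h]
  · intro i j hij a ha b hb
    exact (hsupp.1 ha).1.2.trans_le
      ((htmono.monotone (Nat.succ_le_of_lt hij)).trans (hsupp.1 hb).1.1)
  · have : minima (fun i : Fin M'.card => suppOn y (Ico (t i) (t (i + 1))) v) = M' := by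
      refine Eq.trans ?_ (image_orderEmbOfFin_univ M' rfl)
      refine image_congr fun i _ => le_antisymm (sInf_le_of_mem (hot i)) ?_
      rw [← ho, ← hto]
      exact (hsupp.1 (sInf_mem_of_nonempty ⟨_, hot i⟩)).1.1
    rwa [this]

theorem exists_seminorm_eq_averagedNorm (hbi : IsBimonotone y fun v => ‖v‖)
    {F : Set (Finset ℕ)} (hF : AbsorbsThickenings F 1 id) (hF1 : ∀ m, {m} ∈ F) {n : ℕ}
    (hn : 1 ≤ n) {θ : ℝ} (hθ0 : 0 ≤ θ)
    (hθ : θ ^ n = asymConst (famPow F n) y fun v => ‖v‖) :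
    ∃ p : Seminorm ℝ Y, IsEquivalentNorm p ∧ IsBimonotone y p ∧
      (∀ v, p v = averagedNorm y F θ n v) ∧ θ ≤ asymConst F y p := by
  have hef := biorthogonal_coordMap y
  have hq : BimonotoneSeminorm y (coordMap y) (normSeminorm ℝ Y) := fun a b v => by
    rw [← proj_eq_coordProj]
    exact hbi a b v
  have hlow : LowerEstimate y (normSeminorm ℝ Y) (famPow F n) (θ ^ n) := by
    rw [hθ]
    exact lowerEstimate_asymConst _ _ (normSeminorm ℝ Y)
  obtain ⟨p, hp, ⟨c, C, hc, hC, hcC⟩, hpbi, hplow⟩ :=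
    exists_averaged_seminorm hef hq (determinedByInitialSegments_norm y) hF hF1 hn hθ0 hlow
  refine ⟨p, ⟨c, C, hc, hC, hcC⟩, fun a b v => ?_, fun v => ?_, ?_⟩
  · rw [proj_eq_coordProj]
    exact hpbi a b v
  · rw [hp, averagedNorm]
    congr 1
    refine sum_congr rfl fun j hj => ?_
    obtain ⟨D, -, hD⟩ := exists_blockBounded_famPow hef hq hF hF1 hθ0 hlow (mem_range.1 hj)
    exact (layerNorm_eq_blockNorm hq (hF.famPow j)
      (monotone_famPow hF hF1 (Nat.zero_le j) (Or.inl rfl)) (pow_nonneg hθ0 j) hD v).symm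
  · exact hplow.le_asymConst (hF1 0)
      ((mul_pos hc (norm_basis_pos y 0)).trans_le (hcC (y 0)).1) hθ0

variable (y)

/-- The supremum of the norms of all interval restrictions is an equivalent norm. -/
theorem exists_iSup_interval_seminorm [CompleteSpace Y] : ∃ (Q : Seminorm ℝ Y) (C : ℝ), 0 < C ∧
    (∀ v, Q v = ⨆ c : ℕ × ℕ, normSeminorm ℝ Y (coordProj y (coordMap y) (Ico c.1 c.2) v)) ∧
    (∀ a b v, ‖coordProj y (coordMap y) (Ico a b) v‖ ≤ Q v) ∧
    ∀ v, ‖v‖ ≤ Q v ∧ Q v ≤ C * ‖v‖ := by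
  obtain ⟨K, hK⟩ := SchauderBasis.exists_norm_proj_le y
  have hK0 : 0 ≤ K := (norm_nonneg _).trans (hK 0)
  have hKv : ∀ n v, ‖coordProj y (coordMap y) (range n) v‖ ≤ K * ‖v‖ := fun n v => by
    rw [← proj_eq_coordProj]
    exact (SchauderBasis.proj y n).le_of_opNorm_le (hK n) v
  -- An interval restriction is a difference of two initial projections, whence `2 * K`; the `+ 1`
  -- makes the constant positive.
  have hbound : ∀ (c : ℕ × ℕ) v,
      ‖coordProj y (coordMap y) (Ico c.1 c.2) v‖ ≤ (2 * K + 1) * ‖v‖ := by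
    rintro ⟨a, b⟩ v
    have hv := norm_nonneg v
    rcases le_total a b with h | h
    · have heq : coordProj y (coordMap y) (Ico a b) v =
          coordProj y (coordMap y) (range b) v - coordProj y (coordMap y) (range a) v := by
        simp only [coordProj_apply]
        exact sum_Ico_eq_sub _ h
      calc ‖coordProj y (coordMap y) (Ico a b) v‖
          ≤ K * ‖v‖ + K * ‖v‖ := by
            rw [heq]
            exact (norm_sub_le _ _).trans (add_le_add (hKv b v) (hKv a v))
        _ ≤ (2 * K + 1) * ‖v‖ := by linarith
    · dsimp only
      rw [Ico_eq_empty_of_le h, coordProj_apply, sum_empty, norm_zero]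
      positivity
  have hbdd : ∀ v, BddAbove (Set.range fun c : ℕ × ℕ =>
      ‖coordProj y (coordMap y) (Ico c.1 c.2) v‖) := fun v => by
    refine ⟨(2 * K + 1) * ‖v‖, ?_⟩
    rintro _ ⟨c, rfl⟩
    exact hbound c v
  have hle : ∀ (c : ℕ × ℕ) v, ‖coordProj y (coordMap y) (Ico c.1 c.2) v‖ ≤
      ⨆ c : ℕ × ℕ, ‖coordProj y (coordMap y) (Ico c.1 c.2) v‖ := fun c v => le_ciSup (hbdd v) c
  refine ⟨Seminorm.of (fun v => ⨆ c : ℕ × ℕ, ‖coordProj y (coordMap y) (Ico c.1 c.2) v‖)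
    (fun u v => ciSup_le fun c => ?_) (fun r v => ?_), 2 * K + 1, by positivity, fun v => rfl,
    fun a b v => hle (a, b) v, fun v => ⟨?_, ciSup_le fun c => hbound c v⟩⟩
  · rw [map_add]
    exact (norm_add_le _ _).trans (add_le_add (hle c u) (hle c v))
  · rw [Real.mul_iSup_of_nonneg (norm_nonneg r)]
    exact iSup_congr fun c => by rw [map_smul, norm_smul]
  · exact le_of_tendsto' (tendsto_coordProj_Ico y v).norm fun N => hle (0, N) v

/-! ### Subsequences of the basis -/

theorem isBlockBasis_comp {ν : ℕ → ℕ} (hν : StrictMono ν) : IsBlockBasis y (y ∘ ν) := by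
  refine ⟨fun i => Finsupp.single (ν i) 1, fun i => by simp, fun i j hij a ha b hb => ?_,
    fun i => by simp⟩
  have ha' := Finsupp.support_single_subset ha
  have hb' := Finsupp.support_single_subset hb
  rw [mem_singleton] at ha' hb'
  rw [ha', hb']
  exact hν hij

theorem coordMap_eq_zero_of_mem_closedSpan {ν : ℕ → ℕ} {v : Y} (hv : v ∈ closedSpan (y ∘ ν))
    {j : ℕ} (hj : ∀ i, ν i ≠ j) : coordMap y j v = 0 := by
  have hle : closedSpan (y ∘ ν) ≤ LinearMap.ker (y.coord j : Y →ₗ[ℝ] ℝ) := by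
    refine Submodule.topologicalClosure_minimal _ (Submodule.span_le.2 ?_) ?_
    · rintro _ ⟨i, rfl⟩
      have := biorthogonal_coordMap y j (ν i)
      rw [if_neg (hj i).symm] at this
      exact this
    · exact ContinuousLinearMap.isClosed_ker (y.coord j)
  exact hle hv

variable (ν : ℕ → ℕ)

/-- The coordinate functionals of a subsequence of the basis. -/
def subCoordMap (i : ℕ) : closedSpan (y ∘ ν) →ₗ[ℝ] ℝ :=
  coordMap y (ν i) ∘ₗ (closedSpan (y ∘ ν)).subtype

variable {ν}

theorem biorthogonal_subCoordMap (hν : StrictMono ν) :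
    Biorthogonal (toClosedSpan (y ∘ ν)) (subCoordMap y ν) := fun i j => by
  have h := biorthogonal_coordMap y (ν i) (ν j)
  simp only [hν.injective.eq_iff] at h
  exact h

theorem coe_coordProj_subCoordMap (hν : StrictMono ν) (E : Finset ℕ) (v : closedSpan (y ∘ ν)) :
    (coordProj (toClosedSpan (y ∘ ν)) (subCoordMap y ν) E v : Y) =
      coordProj y (coordMap y) (E.image ν) v := by
  rw [coordProj_apply, coordProj_apply, sum_image hν.injective.injOn, Submodule.coe_sum]
  rfl

theorem coe_linearCombination_toClosedSpan (a : ℕ →₀ ℝ) :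
    (Finsupp.linearCombination ℝ (toClosedSpan (y ∘ ν)) a : Y) =
      Finsupp.linearCombination ℝ (y ∘ ν) a :=
  Finsupp.apply_linearCombination ℝ (closedSpan (y ∘ ν)).subtype (toClosedSpan (y ∘ ν)) a

/-- Coordinates off the range of `ν` vanish on the closed span, so intervals of the subsequence act
as intervals of the basis and bimonotonicity carries over. -/
theorem coordProj_Ico_of_mem_closedSpan (hν : StrictMono ν) (a b : ℕ) (v : closedSpan (y ∘ ν)) :
    coordProj y (coordMap y) ((Ico a b).image ν) v =
      coordProj y (coordMap y) (Ico (ν a) (ν b)) v := by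
  refine coordProj_congr fun i => ?_
  by_cases hi : ∃ j, ν j = i
  · obtain ⟨j, rfl⟩ := hi
    have : ν j ∈ (Ico a b).image ν ↔ ν j ∈ Ico (ν a) (ν b) := by
      rw [hν.injective.mem_finset_image, mem_Ico, mem_Ico, hν.le_iff_le, hν.lt_iff_lt]
    simp only [this]
  · simp [coordMap_eq_zero_of_mem_closedSpan y v.2 fun j h => hi ⟨j, h⟩]

theorem exists_subsequence_seminorm [CompleteSpace Y] {F : Set (Finset ℕ)}
    (hF : AbsorbsThickenings F 1 id) (hF1 : ∀ m, {m} ∈ F) {g : ℕ → ℕ} (hg : ∀ m, m ≤ g m)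
    (hFg : AbsorbsThickenings F 3 g) {n : ℕ} (hn : 1 ≤ n) {θ : ℝ} (hθ0 : 0 ≤ θ)
    (hθ : LowerEstimate y (normSeminorm ℝ Y) (famPow F n) (θ ^ n)) :
    ∃ x : ℕ → Y, IsBlockBasis y x ∧ ∃ p : Seminorm ℝ (closedSpan x), IsEquivalentNorm p ∧
      θ ≤ asymConst F (toClosedSpan x) p := by
  -- A strictly increasing majorant of `g`.
  set ν : ℕ → ℕ := fun i => i + ∑ j ∈ range (i + 1), g j with hνdef
  have hν : StrictMono ν := strictMono_nat_of_lt_succ fun i => by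
    simp only [hνdef, sum_range_succ _ (i + 1)]
    omega
  have hgν : ∀ i, g i ≤ ν i := fun i => by
    simp only [hνdef, sum_range_succ]
    omega
  obtain ⟨n, rfl⟩ := Nat.exists_eq_add_of_le' hn
  have hef := biorthogonal_coordMap y
  obtain ⟨Q, C, hC, hQ, hPQ, hnQ⟩ := exists_iSup_interval_seminorm y
  have hsub := biorthogonal_subCoordMap y hν
  let q : Seminorm ℝ (closedSpan (y ∘ ν)) := Q.comp (closedSpan (y ∘ ν)).subtype
  have hq : ∀ v, q v = Q v := fun v => rfl
  have hQcomp : ∀ (E : Finset ℕ) (a b : ℕ) (v : Y),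
      coordProj y (coordMap y) (Ico a b) (coordProj y (coordMap y) E v) =
        coordProj y (coordMap y) E (coordProj y (coordMap y) (Ico a b) v) := fun E a b v => by
    rw [hef.coordProj_coordProj, hef.coordProj_coordProj, inter_comm]
  have hbi : BimonotoneSeminorm (toClosedSpan (y ∘ ν)) (subCoordMap y ν) q := by
    intro a b v
    rw [hq, hq, coe_coordProj_subCoordMap y hν, coordProj_Ico_of_mem_closedSpan y hν, hQ]
    refine ciSup_le fun c => ?_
    rw [hef.coordProj_coordProj, Ico_inter_Ico]
    exact hPQ _ _ _
  have hlim : DeterminedByInitialSegments (toClosedSpan (y ∘ ν)) (subCoordMap y ν) q := by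
    intro v r hr
    rw [hq, hQ]
    -- Since `j ≤ ν j`, the first `c.2` terms of the subsequence include all those with basis index
    -- below `c.2`.
    refine ciSup_le fun c => le_trans ?_ (hr c.2)
    rw [hq, coe_coordProj_subCoordMap y hν]
    refine le_trans (le_of_eq ?_) (hPQ c.1 c.2 _)
    rw [hef.coordProj_coordProj, coe_normSeminorm]
    congr 1
    refine coordProj_congr fun i => ?_
    by_cases hi : ∃ j, ν j = i
    · obtain ⟨j, rfl⟩ := hi
      have : ν j ∈ Ico c.1 c.2 ↔ ν j ∈ Ico c.1 c.2 ∩ (Ico 0 c.2).image ν := by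
        rw [mem_inter, hν.injective.mem_finset_image, mem_Ico, mem_Ico]
        have := hν.id_le j
        simp only [id] at this
        omega
      simp only [← this]
    · simp [coordMap_eq_zero_of_mem_closedSpan y v.2 fun j h => hi ⟨j, h⟩]
  have hlow : LowerEstimate (toClosedSpan (y ∘ ν)) q (famPow F (n + 1)) (θ ^ (n + 1)) := by
    intro k a ha
    have h := hθ.comp_of_absorbsThickenings hef (pow_nonneg hθ0 _) (hF.famPow_succ hFg hg n) hν hgν
      hQ (fun v => (hnQ v).1) k a ha
    simpa only [hq, coe_linearCombination_toClosedSpan, Submodule.coe_sum] using h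
  obtain ⟨p, -, ⟨c, D, hc, hD, hcD⟩, -, hplow⟩ :=
    exists_averaged_seminorm hsub hbi hlim hF hF1 hn hθ0 hlow
  have hequiv : ∀ v, c * ‖v‖ ≤ p v ∧ p v ≤ D * C * ‖v‖ := fun v => by
    refine ⟨(mul_le_mul_of_nonneg_left (hnQ v).1 hc.le).trans (hcD v).1, (hcD v).2.trans ?_⟩
    rw [mul_assoc]
    exact mul_le_mul_of_nonneg_left (hnQ v).2 hD.le
  refine ⟨y ∘ ν, isBlockBasis_comp y hν, p, ⟨c, D * C, hc, by positivity, hequiv⟩, ?_⟩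
  exact hplow.le_asymConst (hF1 0)
    ((mul_pos hc (norm_basis_pos y (ν 0))).trans_le (hequiv (toClosedSpan (y ∘ ν) 0)).1) hθ0

theorem exists_blockBasis_seminorm_schreierZero {F : Set (Finset ℕ)}
    (hF : AbsorbsThickenings F 1 id) (hF1 : ∀ m, {m} ∈ F) {n : ℕ} (hn : 1 ≤ n) {θ : ℝ}
    (hθ : LowerEstimate y (normSeminorm ℝ Y) (famPow F n) (θ ^ n)) (hθ0 : 0 ≤ θ) :
    ∃ x : ℕ → Y, IsBlockBasis y x ∧ ∃ p : Seminorm ℝ (closedSpan x), IsEquivalentNorm p ∧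
      θ ≤ asymConst schreierZero (toClosedSpan x) p := by
  have hθ1 : θ ≤ 1 := by
    have h := hθ.le_one (monotone_famPow hF hF1 (Nat.zero_le n) (Or.inr ⟨0, rfl⟩))
      (norm_basis_pos y 0)
    exact (pow_le_one_iff_of_nonneg hθ0 (by omega)).1 h
  refine ⟨y ∘ id, isBlockBasis_comp y strictMono_id, normSeminorm ℝ _,
    ⟨1, 1, one_pos, one_pos, fun v => by simp⟩, hθ1.trans ?_⟩
  exact lowerEstimate_schreierZero.le_asymConst (m := 0) (Or.inr ⟨0, rfl⟩) (norm_basis_pos y 0)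
    zero_le_one

end Schauder

end AsymptoticL1

end

theorem theorem4p14 {Y : Type*} [NormedAddCommGroup Y] [NormedSpace ℝ Y] [CompleteSpace Y]
    (y : SchauderBasis ℝ Y)
    (c : Ordinal.{0} → ℕ → Ordinal.{0}) (hc : AsymptoticL1.IsLadder c)
    (α : Ordinal.{0}) (hα : α < ω₁) (n : ℕ) (hn : 1 ≤ n) (θ : ℝ) (hθ0 : 0 ≤ θ)
    (hθ : θ ^ n = AsymptoticL1.asymConst
      (AsymptoticL1.famPow (AsymptoticL1.schreier c α) n) y (fun v => ‖v‖)) :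
    (∀ ε : ℝ, 0 < ε → ∃ x : ℕ → Y, AsymptoticL1.IsBlockBasis y x ∧
      ∃ p : Seminorm ℝ (AsymptoticL1.closedSpan x), AsymptoticL1.IsEquivalentNorm p ∧
        θ - ε ≤ AsymptoticL1.asymConst (AsymptoticL1.schreier c α)
          (AsymptoticL1.toClosedSpan x) p) ∧
    (AsymptoticL1.IsBimonotone y (fun v => ‖v‖) →
      ∃ p : Seminorm ℝ Y, AsymptoticL1.IsEquivalentNorm p ∧ AsymptoticL1.IsBimonotone y p ∧
        (∀ v, p v = AsymptoticL1.averagedNorm y (AsymptoticL1.schreier c α) θ n v) ∧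
        θ ≤ AsymptoticL1.asymConst (AsymptoticL1.schreier c α) y p) := by
  have hF := AsymptoticL1.absorbsThickenings_schreier c α
  have hF1 : ∀ m, {m} ∈ AsymptoticL1.schreier c α := AsymptoticL1.singleton_mem_schreier hc hα
  refine ⟨fun ε hε => ?_, fun hbi =>
    AsymptoticL1.exists_seminorm_eq_averagedNorm hbi hF hF1 hn hθ0 hθ⟩
  have hlow : AsymptoticL1.LowerEstimate y (normSeminorm ℝ Y)
      (AsymptoticL1.famPow (AsymptoticL1.schreier c α) n) (θ ^ n) := by
    rw [hθ]
    exact AsymptoticL1.lowerEstimate_asymConst _ _ (normSeminorm ℝ Y)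
  have hmain : ∃ x : ℕ → Y, AsymptoticL1.IsBlockBasis y x ∧
      ∃ p : Seminorm ℝ (AsymptoticL1.closedSpan x), AsymptoticL1.IsEquivalentNorm p ∧
        θ ≤ AsymptoticL1.asymConst (AsymptoticL1.schreier c α)
          (AsymptoticL1.toClosedSpan x) p := by
    -- `S₀` cannot absorb threefold thickenings, but its constant is at least `1`, and `θ ≤ 1`.
    rcases eq_or_ne α 0 with rfl | h0
    · have h := AsymptoticL1.exists_blockBasis_seminorm_schreierZero y hF hF1 hn hlow hθ0
      rwa [← AsymptoticL1.schreier_zero c] at h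
    · obtain ⟨g, hg, hFg⟩ := AsymptoticL1.exists_absorbsThickenings_schreier hc 3 hα h0
      exact AsymptoticL1.exists_subsequence_seminorm y hF hF1 hg hFg hn hθ0 hlow
  obtain ⟨x, hx, p, hp, hle⟩ := hmain
  exact ⟨x, hx, p, hp, by linarith⟩
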